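/- Let $(M,g)$ be a smooth Riemannian manifold with Levi-Civita connection $\nabla$, and let $x\in M$. We say that $(M,g)$ is a cone at $x$ if there are smooth local coordinates $(r,x^1,\dots,x^l)$ defined on an open neighbourhood of $x$, with $r>0$ there, in which the metric has the form $$g = dr^2 + r^2\sum_{i,j=1}^{l} f_{ij}\,dx^i\,dx^j ,$$ where the functions $f_{ij}$ depend only on $x^1,\dots,x^l$. Then $(M,g)$ is a cone at $x$ if and only if there is a smooth vector field $V$, defined on an open neighbourhood of $x$, with $V(x)\neq 0$, such that $$\nabla_X V + X = 0$$ for every smooth vector field $X$ defined on an open neighbourhood of $x$ (the equation being required at all points where both $V$ and $X$ are defined). -/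

import Mathlib

open Bundle NormedSpace FiberBundle VectorField
open scoped Manifold ContDiff Topology

set_option linter.unusedSectionVars false

noncomputable section

namespace RiemCone

variable {E : Type*} [NormedAddCommGroup E] [NormedSpace ℝ E]
  {H : Type*} [TopologicalSpace H] {I : ModelWithCorners ℝ E H}
  {M : Type*} [TopologicalSpace M] [ChartedSpace H M]
  [RiemannianBundle (fun p : M => TangentSpace I p)]

/-- The right hand side of the Koszul formula (half of it), i.e. the function
`½ (X⟨Y,Z⟩ + Y⟨Z,X⟩ - Z⟨X,Y⟩ + ⟨[X,Y],Z⟩ - ⟨[X,Z],Y⟩ - ⟨[Y,Z],X⟩)` at the point `p`. -/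
def koszul (X Y Z : Π p : M, TangentSpace I p) (p : M) : ℝ :=
  (1 / 2 : ℝ) *
    (mvfderiv I (fun q : M => inner ℝ (Y q) (Z q)) p (X p)
      + mvfderiv I (fun q : M => inner ℝ (Z q) (X q)) p (Y p)
      - mvfderiv I (fun q : M => inner ℝ (X q) (Y q)) p (Z p)
      + inner ℝ (mlieBracket I X Y p) (Z p)
      - inner ℝ (mlieBracket I X Z p) (Y p)
      - inner ℝ (mlieBracket I Y Z p) (X p))

variable [FiniteDimensional ℝ E] [IsManifold I ∞ M]
  [IsContMDiffRiemannianBundle I ∞ E (fun p : M => TangentSpace I p)]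

theorem mdiff_inner {Y Z : Π p : M, TangentSpace I p} {p : M}
    (hY : MDiffAt (T% Y) p) (hZ : MDiffAt (T% Z) p) :
    MDiffAt (fun q : M => (inner ℝ (Y q) (Z q) : ℝ)) p :=
  MDifferentiableAt.inner_bundle (IB := I) (F := E) (E := fun p : M => TangentSpace I p)
    (b := fun q : M => q) hY hZ

theorem koszul_tensorial_left {Y Z : Π p : M, TangentSpace I p} {p : M}
    (hY : MDiffAt (T% Y) p) (hZ : MDiffAt (T% Z) p) :
    TensorialAt I E (fun X => koszul X Y Z p) p where
  smul {f X} hf hX := by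
    have : CompleteSpace E := FiniteDimensional.complete ℝ E
    have e1 : (fun q : M => inner ℝ (Z q) ((f • X) q)) = f * fun q => inner ℝ (Z q) (X q) := by
      ext q; simp [inner_smul_right]
    have e2 : (fun q : M => inner ℝ ((f • X) q) (Y q)) = f * fun q => inner ℝ (X q) (Y q) := by
      ext q; simp [inner_smul_left]
    simp only [koszul]
    rw [e1, e2, mvfderiv_mul hf (mdiff_inner hZ hX), mvfderiv_mul hf (mdiff_inner hX hY),
      mlieBracket_smul_left hf hX, mlieBracket_smul_left hf hX]
    simp [inner_add_left, inner_smul_left, inner_smul_right, real_inner_comm (X p)]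
    ring
  add {X X'} hX hX' := by
    have : CompleteSpace E := FiniteDimensional.complete ℝ E
    have e1 : (fun q : M => inner ℝ (Z q) ((X + X') q))
        = (fun q => inner ℝ (Z q) (X q)) + fun q => inner ℝ (Z q) (X' q) := by
      ext q; simp [inner_add_right]
    have e2 : (fun q : M => inner ℝ ((X + X') q) (Y q))
        = (fun q => inner ℝ (X q) (Y q)) + fun q => inner ℝ (X' q) (Y q) := by
      ext q; simp [inner_add_left]
    simp only [koszul]
    rw [e1, e2, mvfderiv_add (mdiff_inner hZ hX) (mdiff_inner hZ hX'),
      mvfderiv_add (mdiff_inner hX hY) (mdiff_inner hX' hY),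
      mlieBracket_add_left hX hX', mlieBracket_add_left hX hX']
    simp [inner_add_left, inner_add_right]
    ring

theorem koszul_tensorial_right {X Y : Π p : M, TangentSpace I p} {p : M}
    (hX : MDiffAt (T% X) p) (hY : MDiffAt (T% Y) p) :
    TensorialAt I E (fun Z => koszul X Y Z p) p where
  smul {f Z} hf hZ := by
    have : CompleteSpace E := FiniteDimensional.complete ℝ E
    have e1 : (fun q : M => inner ℝ (Y q) ((f • Z) q)) = f * fun q => inner ℝ (Y q) (Z q) := by
      ext q; simp [inner_smul_right]
    have e2 : (fun q : M => inner ℝ ((f • Z) q) (X q)) = f * fun q => inner ℝ (Z q) (X q) := by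
      ext q; simp [inner_smul_left]
    simp only [koszul]
    rw [e1, e2, mvfderiv_mul hf (mdiff_inner hY hZ), mvfderiv_mul hf (mdiff_inner hZ hX),
      mlieBracket_smul_right hf hZ, mlieBracket_smul_right hf hZ]
    simp [inner_add_left, inner_smul_left, inner_smul_right, real_inner_comm (Z p)]
    ring
  add {Z Z'} hZ hZ' := by
    have : CompleteSpace E := FiniteDimensional.complete ℝ E
    have e1 : (fun q : M => inner ℝ (Y q) ((Z + Z') q))
        = (fun q => inner ℝ (Y q) (Z q)) + fun q => inner ℝ (Y q) (Z' q) := by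
      ext q; simp [inner_add_right]
    have e2 : (fun q : M => inner ℝ ((Z + Z') q) (X q))
        = (fun q => inner ℝ (Z q) (X q)) + fun q => inner ℝ (Z' q) (X q) := by
      ext q; simp [inner_add_left]
    simp only [koszul]
    rw [e1, e2, mvfderiv_add (mdiff_inner hY hZ) (mdiff_inner hY hZ'),
      mvfderiv_add (mdiff_inner hZ hX) (mdiff_inner hZ' hX),
      mlieBracket_add_right hZ hZ', mlieBracket_add_right hZ hZ']
    simp [inner_add_left, inner_add_right]
    ring

open scoped Classical in
/-- The Levi-Civita derivative `v ↦ ∇_v Y` at `p` of a vector field `Y` that is differentiable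
at `p`: the vector `∇_v Y` is the one that represents (with respect to the inner product of
`T_p M`) the linear form `w ↦ koszul X Y Z p`, where `X p = v` and `Z p = w`.
(If `Y` is not differentiable at `p`, the value is `0`.) -/
def leviCivitaAux (Y : Π p : M, TangentSpace I p) (p : M) :
    TangentSpace I p →L[ℝ] TangentSpace I p :=
  haveI : FiniteDimensional ℝ (TangentSpace I p) := inferInstanceAs (FiniteDimensional ℝ E)
  haveI : CompleteSpace (TangentSpace I p) := FiniteDimensional.complete ℝ _
  if hY : MDiffAt (T% Y) p then
    LinearMap.toContinuousLinearMap
      { toFun := fun v => (InnerProductSpace.toDual ℝ (TangentSpace I p)).symm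
          (TensorialAt.mkHom₂ (F := E) (F' := E) (fun X Z => koszul X Y Z p) p
            (fun _ hZ => koszul_tensorial_left hY hZ)
            (fun _ hX => koszul_tensorial_right hX hY) v)
        map_add' := by simp
        map_smul' := by simp }
  else 0

theorem inner_leviCivitaAux {X Y Z : Π p : M, TangentSpace I p} {p : M}
    (hX : MDiffAt (T% X) p) (hY : MDiffAt (T% Y) p) (hZ : MDiffAt (T% Z) p) :
    inner ℝ (leviCivitaAux Y p (X p)) (Z p) = koszul X Y Z p := by
  have : FiniteDimensional ℝ (TangentSpace I p) := inferInstanceAs (FiniteDimensional ℝ E)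
  have : CompleteSpace (TangentSpace I p) := FiniteDimensional.complete ℝ _
  rw [leviCivitaAux, dif_pos hY]
  have := TensorialAt.mkHom₂_apply (F := E) (F' := E) (Φ := fun X Z => koszul X Y Z p)
    (fun _ hZ => koszul_tensorial_left hY hZ) (fun _ hX => koszul_tensorial_right hX hY) hX hZ
  rw [← this]
  simp

theorem ext_of_fields {p : M} {A B : TangentSpace I p →L[ℝ] TangentSpace I p}
    (h : ∀ X Z : Π p : M, TangentSpace I p, MDiffAt (T% X) p → MDiffAt (T% Z) p →
      inner ℝ (A (X p)) (Z p) = inner ℝ (B (X p)) (Z p)) : A = B := by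
  ext v
  refine ext_inner_right ℝ fun w => ?_
  simpa using h (extend E v) (extend E w) (mdifferentiableAt_extend ..)
    (mdifferentiableAt_extend ..)

variable (I M) in
/-- The Levi-Civita connection of the Riemannian manifold `M`. Here `leviCivita I M Y p v` is the
covariant derivative `∇_v Y` at `p`. The theorems below show that it is torsion free and
compatible with the metric. -/
def leviCivita : CovariantDerivative I E (fun p : M => TangentSpace I p) where
  toFun := leviCivitaAux
  isCovariantDerivativeOnUniv :=
    { add := by
        intro Y Y' p hY hY' _
        have : CompleteSpace E := FiniteDimensional.complete ℝ E
        refine ext_of_fields fun X Z hX hZ => ?_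
        have e1 : (fun q : M => inner ℝ ((Y + Y') q) (Z q))
            = (fun q => inner ℝ (Y q) (Z q)) + fun q => inner ℝ (Y' q) (Z q) := by
          ext q; simp [inner_add_left]
        have e2 : (fun q : M => inner ℝ (X q) ((Y + Y') q))
            = (fun q => inner ℝ (X q) (Y q)) + fun q => inner ℝ (X q) (Y' q) := by
          ext q; simp [inner_add_right]
        rw [add_apply, inner_add_left,
          inner_leviCivitaAux hX (mdifferentiableAt_add_section hY hY') hZ,
          inner_leviCivitaAux hX hY hZ, inner_leviCivitaAux hX hY' hZ]
        simp only [koszul]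
        rw [e1, e2, mvfderiv_add (mdiff_inner hY hZ) (mdiff_inner hY' hZ),
          mvfderiv_add (mdiff_inner hX hY) (mdiff_inner hX hY'),
          mlieBracket_add_right hY hY', mlieBracket_add_left hY hY']
        simp [inner_add_left, inner_add_right]
        ring
      leibniz := by
        intro Y f p hY hf _
        have : CompleteSpace E := FiniteDimensional.complete ℝ E
        refine ext_of_fields fun X Z hX hZ => ?_
        have e1 : (fun q : M => inner ℝ ((f • Y) q) (Z q))
            = f * fun q => inner ℝ (Y q) (Z q) := by
          ext q; simp [inner_smul_left]
        have e2 : (fun q : M => inner ℝ (X q) ((f • Y) q))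
            = f * fun q => inner ℝ (X q) (Y q) := by
          ext q; simp [inner_smul_right]
        rw [add_apply, inner_add_left, smul_apply,
          inner_smul_left, inner_leviCivitaAux hX (hf.smul_section hY) hZ,
          inner_leviCivitaAux hX hY hZ]
        simp only [koszul]
        rw [e1, e2, mvfderiv_mul hf (mdiff_inner hY hZ), mvfderiv_mul hf (mdiff_inner hX hY),
          mlieBracket_smul_right hf hY, mlieBracket_smul_left hf hY]
        simp [inner_add_left, inner_smul_left, inner_smul_right, real_inner_comm (Y p)]
        ring }

/-- The Levi-Civita connection is characterized by the Koszul formula. -/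
theorem inner_leviCivita {X Y Z : Π p : M, TangentSpace I p} {p : M}
    (hX : MDiffAt (T% X) p) (hY : MDiffAt (T% Y) p) (hZ : MDiffAt (T% Z) p) :
    inner ℝ (leviCivita I M Y p (X p)) (Z p) = koszul X Y Z p :=
  inner_leviCivitaAux hX hY hZ

/-- The Levi-Civita connection is torsion free. -/
theorem leviCivita_torsion {X Y : Π p : M, TangentSpace I p} {p : M}
    (hX : MDiffAt (T% X) p) (hY : MDiffAt (T% Y) p) :
    leviCivita I M Y p (X p) - leviCivita I M X p (Y p) = mlieBracket I X Y p := by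
  refine ext_inner_right ℝ fun w => ?_
  have hZ := mdifferentiableAt_extend (I := I) (F := E) (V := fun p : M => TangentSpace I p) w
  have hw : w = (extend E w : Π p : M, TangentSpace I p) p := by simp
  rw [hw, inner_sub_left, inner_leviCivita hX hY hZ, inner_leviCivita hY hX hZ]
  simp only [koszul, mlieBracket_swap_apply (V := Y) (W := X), real_inner_comm]
  simp
  ring

/-- The Levi-Civita connection is compatible with the metric. -/
theorem leviCivita_metric {X Y Z : Π p : M, TangentSpace I p} {p : M}
    (hX : MDiffAt (T% X) p) (hY : MDiffAt (T% Y) p) (hZ : MDiffAt (T% Z) p) :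
    mvfderiv I (fun q : M => inner ℝ (Y q) (Z q)) p (X p)
      = inner ℝ (leviCivita I M Y p (X p)) (Z p)
        + inner ℝ (Y p) (leviCivita I M Z p (X p)) := by
  rw [real_inner_comm _ (Y p), inner_leviCivita hX hY hZ, inner_leviCivita hX hZ hY]
  simp only [koszul, mlieBracket_swap_apply (V := Z) (W := Y)]
  simp [real_inner_comm]
  ring

variable (I) in
/-- `M` is a cone at `x`: there are smooth coordinates `φ = (r, x¹, …, xˡ)`, `r > 0`, on an open
neighbourhood `φ.source` of `x`, in which the metric is `dr² + r² ∑ f_ij dxⁱ dxʲ`, where the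
coefficients `f_ij` are functions of `x¹, …, xˡ` only. The metric is compared with the right hand
side as a bilinear form, so that the matrix `f_ij` is automatically symmetric, positive definite and
smooth on the range of the coordinates `(x¹, …, xˡ)`. -/
def IsConeAt (x : M) : Prop :=
  ∃ (l : ℕ) (φ : OpenPartialHomeomorph M (ℝ × (Fin l → ℝ)))
    (f : Fin l → Fin l → (Fin l → ℝ) → ℝ),
    x ∈ φ.source ∧
    ContMDiffOn I 𝓘(ℝ, ℝ × (Fin l → ℝ)) ∞ φ φ.source ∧
    ContMDiffOn 𝓘(ℝ, ℝ × (Fin l → ℝ)) I ∞ φ.symm φ.target ∧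
    (∀ p ∈ φ.source, 0 < (φ p).1) ∧
    ∀ p ∈ φ.source, ∀ v w : TangentSpace I p,
      inner ℝ v w =
        mvfderiv I (fun q : M => (φ q).1) p v * mvfderiv I (fun q : M => (φ q).1) p w
        + (φ p).1 ^ 2 * ∑ i, ∑ j, f i j (φ p).2 *
            (mvfderiv I (fun q : M => (φ q).2 i) p v * mvfderiv I (fun q : M => (φ q).2 j) p w)

/-- `V` is a smooth vector field on the set `U`. Its values outside `U` are irrelevant. -/
def IsSmoothFieldOn (V : Π p : M, TangentSpace I p) (U : Set M) : Prop :=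
  ContMDiffOn I I.tangent ∞ (fun p : M => (⟨p, V p⟩ : TangentBundle I M)) U

end RiemCone

end

/-!
# Riemannian cones and fields with `∇V = -1`

If the metric is `dr² + r² ∑ f_ij dxⁱ dxʲ`, the field is `V = -r ∂/∂r`: evaluating the Koszul formula
on coordinate fields gives `⟨∇_X V, Z⟩ = -⟨X, Z⟩` (`RiemCone.leviCivita_radial`).

Conversely, let `∇V = -1` near `x` with `V x ≠ 0`, and put `r = |V| > 0`. Compatibility with the
metric gives `r dr = -⟨V, ·⟩` (`RiemCone.mvfderiv_norm`), so `V r = -r` and `V` is orthogonal to the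
level sets of `r`. Since `V` does not vanish, it has a full set of first integrals `x¹, …, xˡ`, and
`(r, x¹, …, xˡ)` are coordinates in which `V = -r ∂/∂r` (`RiemCone.exists_adaptedCoord`). The
orthogonality splits the metric as `dr²` plus a part along the `xⁱ`
(`RiemCone.inner_eq_radial_add_transverse`). As `∂/∂xⁱ` commutes with `V`, torsion freeness gives
`∇_V ∂ᵢ = ∇_{∂ᵢ} V = -∂ᵢ`, hence `V g_ij = -2 g_ij`, that is `r ∂_r g_ij = 2 g_ij`. On coordinates with
range a ball this integrates to `g_ij = r² f_ij(x)` (`RiemCone.transverse_metric_eq`).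

The existence of first integrals (`RiemCone.exists_firstIntegrals`) rests on the smooth dependence of
the flow of a smooth vector field `v` on time and initial point (`RiemCone.exists_contDiffAt_flow`).
It is obtained from the implicit function theorem in the Banach space of continuous curves on
`[0, 1]`, applied to the equation `γ(s) = x + t ∫₀ˢ v(γ)`, which has the constant solution `γ = x` at
`t = 0`; that the equation is smooth in `γ` is `RiemCone.contDiff_postcomp`.
-/

set_option synthInstance.maxHeartbeats 200000

namespace RiemCone


/-! ### Composition operators on spaces of continuous curves -/

section CompositionOperator

universe u

variable {K : Type*} [TopologicalSpace K] [CompactSpace K]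
  {E F : Type u} [NormedAddCommGroup E] [NormedSpace ℝ E] [NormedAddCommGroup F] [NormedSpace ℝ F]

/-- Pointwise application of a continuous family of operators to a continuous curve, as a bounded
bilinear map. -/
noncomputable def pointwiseApply (K : Type*) [TopologicalSpace K] [CompactSpace K]
    (E F : Type u) [NormedAddCommGroup E] [NormedSpace ℝ E]
    [NormedAddCommGroup F] [NormedSpace ℝ F] :
    C(K, E →L[ℝ] F) →L[ℝ] C(K, E) →L[ℝ] C(K, F) :=
  LinearMap.mkContinuous₂
    (LinearMap.mk₂ ℝ (fun (A : C(K, E →L[ℝ] F)) (η : C(K, E)) =>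
        (⟨fun s => A s (η s), A.continuous.clm_apply η.continuous⟩ : C(K, F)))
      (fun _ _ _ => by ext; simp) (fun _ _ _ => by ext; simp)
      (fun _ _ _ => by ext; simp) (fun _ _ _ => by ext; simp)) 1
    (fun A η => by
      rw [one_mul, ContinuousMap.norm_le _ (by positivity)]
      intro s
      exact (A s).le_of_opNorm_le_of_le (A.norm_coe_le_norm s) (η.norm_coe_le_norm s))

@[simp] theorem pointwiseApply_apply (A : C(K, E →L[ℝ] F)) (η : C(K, E)) (s : K) :
    pointwiseApply K E F A η s = A s (η s) := rfl

theorem hasFDerivAt_postcomp {v : E → F} (hv : ContDiff ℝ 1 v) (γ : C(K, E)) :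
    HasFDerivAt (fun γ : C(K, E) => (⟨v, hv.continuous⟩ : C(E, F)).comp γ)
      (pointwiseApply K E F
        ((⟨fderiv ℝ v, hv.continuous_fderiv one_ne_zero⟩ : C(E, E →L[ℝ] F)).comp γ)) γ := by
  have hd := hv.continuous_fderiv one_ne_zero
  rw [hasFDerivAt_iff_isLittleO_nhds_zero, Asymptotics.isLittleO_iff]
  intro ε hε
  have hK : IsCompact (Set.range γ) := isCompact_range γ.continuous
  have huc := hK.uniformContinuousAt_of_continuousAt (fderiv ℝ v) (fun _ _ => hd.continuousAt)
    (Metric.dist_mem_uniformity hε)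
  obtain ⟨δ, hδ, hδ'⟩ := Metric.mem_uniformity_dist.1 huc
  filter_upwards [Metric.ball_mem_nhds (0 : C(K, E)) hδ] with h hh
  rw [mem_ball_zero_iff] at hh
  rw [ContinuousMap.norm_le _ (by positivity)]
  intro s
  have hs : ‖h s‖ < δ := (h.norm_coe_le_norm s).trans_lt hh
  have key : ‖v (γ s + h s) - v (γ s) - fderiv ℝ v (γ s) (γ s + h s - γ s)‖
      ≤ ε * ‖γ s + h s - γ s‖ := by
    refine (convex_ball (γ s) δ).norm_image_sub_le_of_norm_fderivWithin_le' (𝕜 := ℝ) ?_ ?_ ?_ ?_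
    · exact (hv.differentiable one_ne_zero).differentiableOn
    · intro y hy
      rw [fderivWithin_of_isOpen Metric.isOpen_ball hy, ← dist_eq_norm, dist_comm]
      exact (hδ' (a := γ s) (b := y) (by rw [dist_comm]; exact hy) ⟨s, rfl⟩).le
    · exact Metric.mem_ball_self hδ
    · simpa using hs
  simp only [add_sub_cancel_left] at key
  exact key.trans (mul_le_mul_of_nonneg_left (h.norm_coe_le_norm s) hε.le)

/-- Composition with a smooth map is a smooth operator on curves: its derivative is again given by
composition, with the derivative of the map, so induction on the order applies. -/
theorem contDiff_postcomp_nat (n : ℕ) : ∀ {F : Type u} [NormedAddCommGroup F] [NormedSpace ℝ F]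
    {v : E → F} (hv : ContDiff ℝ ∞ v),
    ContDiff ℝ n (fun γ : C(K, E) => (⟨v, hv.continuous⟩ : C(E, F)).comp γ) := by
  induction n with
  | zero =>
    intro F _ _ v hv
    exact contDiff_zero.2 (ContinuousMap.continuous_postcomp _)
  | succ n ih =>
    intro F _ _ v hv
    have hv1 : ContDiff ℝ 1 v := hv.of_le (by exact_mod_cast le_top)
    push_cast
    rw [contDiff_succ_iff_fderiv]
    refine ⟨fun γ => (hasFDerivAt_postcomp hv1 γ).differentiableAt, by simp, ?_⟩
    have : fderiv ℝ (fun γ : C(K, E) => (⟨v, hv.continuous⟩ : C(E, F)).comp γ) =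
        fun γ => pointwiseApply K E F
          ((⟨fderiv ℝ v, hv1.continuous_fderiv one_ne_zero⟩ : C(E, E →L[ℝ] F)).comp γ) :=
      funext fun γ => (hasFDerivAt_postcomp hv1 γ).fderiv
    rw [this]
    exact (pointwiseApply K E F).contDiff.comp (ih (hv.fderiv_right (m := ∞) le_rfl))

theorem contDiff_postcomp {v : E → F} (hv : ContDiff ℝ ∞ v) :
    ContDiff ℝ ∞ (fun γ : C(K, E) => (⟨v, hv.continuous⟩ : C(E, F)).comp γ) :=
  contDiff_infty.2 fun n => contDiff_postcomp_nat n hv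

end CompositionOperator


/-! ### Smoothness of implicit and inverse functions near the base point -/

section Local

variable {E F G : Type*} [NormedAddCommGroup E] [NormedSpace ℝ E] [CompleteSpace E]
  [NormedAddCommGroup F] [NormedSpace ℝ F]
  [NormedAddCommGroup G] [NormedSpace ℝ G] [CompleteSpace G]

/-- `ContDiffAt ℝ ∞` at one point does not give it at the nearby points, so the smoothness of an
implicit function near its base point needs an argument: it agrees with the implicit functions
based at the nearby points of its graph. -/
theorem eventually_contDiffAt_implicitFunction {f : E × F → F} [CompleteSpace F]
    (hf : ContDiff ℝ ∞ f) {u : E × F} (hne : (∞ : WithTop ℕ∞) ≠ 0)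
    (hinv : (fderiv ℝ f u ∘L .inr ℝ E F).IsInvertible) :
    ∀ᶠ z in 𝓝 u.1, ContDiffAt ℝ ∞ (hf.contDiffAt.implicitFunction hne hinv) z := by
  set Γ := hf.contDiffAt.implicitFunction hne hinv with hΓ
  have hΓc : ContinuousAt (fun z => (z, Γ z)) u.1 :=
    continuousAt_id.prodMk (hf.contDiffAt.contDiffAt_implicitFunction hne hinv).continuousAt
  have hΓu : (u.1, Γ u.1) = u :=
    Prod.ext rfl (hf.contDiffAt.implicitFunction_apply_self hne hinv)
  have hΓt : Filter.Tendsto (fun z => (z, Γ z)) (𝓝 u.1) (𝓝 u) := by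
    have := hΓc.tendsto
    rwa [hΓu] at this
  have h1 : ∀ᶠ w in 𝓝 u, (fderiv ℝ f w ∘L .inr ℝ E F).IsInvertible := by
    have hc : Continuous fun w => fderiv ℝ f w ∘L .inr ℝ E F :=
      (hf.continuous_fderiv hne).clm_comp continuous_const
    obtain ⟨A, hA⟩ := hinv
    have hA' := ContinuousLinearEquiv.nhds A
    rw [hA] at hA'
    exact hc.continuousAt.eventually_mem hA'
  have h2 := (hf.contDiffAt.eventually_apply_eq_iff_implicitFunction hne hinv).eventually_nhds
  filter_upwards [hΓt.eventually h1, hΓt.eventually h2,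
    hf.contDiffAt.eventually_apply_implicitFunction hne hinv] with z hz1 hz2 hz3
  have hcz := hf.contDiffAt.contDiffAt_implicitFunction (u := (z, Γ z)) hne hz1
  refine hcz.congr_of_eventuallyEq ?_
  set Γz := hf.contDiffAt.implicitFunction (u := (z, Γ z)) hne hz1 with hΓz
  have ht : Filter.Tendsto (fun z' => (z', Γz z')) (𝓝 z) (𝓝 (z, Γ z)) := by
    have := (continuousAt_id.prodMk hcz.continuousAt).tendsto
    have h0 : Γz z = Γ z :=
      hf.contDiffAt.implicitFunction_apply_self (u := (z, Γ z)) hne hz1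
    rwa [id, h0] at this
  filter_upwards [ht.eventually hz2,
    hf.contDiffAt.eventually_apply_implicitFunction (u := (z, Γ z)) hne hz1] with z' h3 h4
  exact h3.1 (h4.trans hz3)

/-- The local inverse of a smooth map is smooth near the base point, not only at it. -/
theorem eventually_contDiffAt_symm {g : E → G} {a : E} (hg : ∀ᶠ z in 𝓝 a, ContDiffAt ℝ ∞ g z)
    {L : E ≃L[ℝ] G} (hL : HasFDerivAt g (L : E →L[ℝ] G) a) (e : OpenPartialHomeomorph E G)
    (he : (e : E → G) = g) (ha : a ∈ e.source) :
    ∀ᶠ w in 𝓝 (g a), ContDiffAt ℝ ∞ e.symm w := by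
  have hat : g a ∈ e.target := by rw [← he]; exact e.map_source ha
  have hinv : e.symm (g a) = a := by rw [← he]; exact e.left_inv ha
  have h1 : ∀ᶠ z in 𝓝 a, ∃ L' : E ≃L[ℝ] G, HasFDerivAt g (L' : E →L[ℝ] G) z := by
    have hc : ContinuousAt (fderiv ℝ g) a := hg.self_of_nhds.continuousAt_fderiv (by simp)
    have hL' := ContinuousLinearEquiv.nhds L
    rw [← hL.fderiv] at hL'
    filter_upwards [hc.eventually_mem hL', hg] with z ⟨A, hA⟩ hz
    refine ⟨A, ?_⟩
    rw [hA]
    exact (hz.differentiableAt (by simp)).hasFDerivAt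
  have ht : Filter.Tendsto e.symm (𝓝 (g a)) (𝓝 a) := by
    have := e.continuousAt_symm hat
    rwa [ContinuousAt, hinv] at this
  filter_upwards [ht.eventually h1, ht.eventually hg, e.open_target.mem_nhds hat]
    with w ⟨L', hw1⟩ hw2 hw3
  exact e.contDiffAt_symm hw3 (by rwa [he]) (by rwa [he])

end Local

/-! ### The local flow of a smooth vector field -/

section Flow

universe u

variable {E : Type u} [NormedAddCommGroup E] [NormedSpace ℝ E]

open unitInterval MeasureTheory

variable (E) in
/-- The operator sending a curve `η` on `[0, 1]` to its primitive `s ↦ ∫₀ˢ η`. -/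
noncomputable def primitiveL : C(I, E) →L[ℝ] C(I, E) :=
  LinearMap.mkContinuous
    { toFun := fun η => ⟨fun s => ∫ τ in (0 : ℝ)..s, Set.IccExtend zero_le_one η τ,
        (intervalIntegral.continuous_primitive
          (fun _ _ => (η.continuous.Icc_extend' (h := zero_le_one)).intervalIntegrable _ _) 0).comp
          continuous_subtype_val⟩
      map_add' := fun η ζ => by
        ext s
        exact intervalIntegral.integral_add
          ((η.continuous.Icc_extend' (h := zero_le_one)).intervalIntegrable _ _)
          ((ζ.continuous.Icc_extend' (h := zero_le_one)).intervalIntegrable _ _)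
      map_smul' := fun c η => by
        ext s
        exact intervalIntegral.integral_smul c (Set.IccExtend zero_le_one η) } 1
    (fun η => by
      rw [ContinuousMap.norm_le _ (by positivity)]
      intro s
      refine (intervalIntegral.norm_integral_le_of_norm_le_const
        (C := ‖η‖) fun τ _ => η.norm_coe_le_norm _).trans ?_
      rw [sub_zero, abs_of_nonneg s.2.1, mul_comm]
      exact mul_le_mul_of_nonneg_right s.2.2 (norm_nonneg _))

variable (E) in
/-- The constant curves, as a bounded linear map. -/
noncomputable def constCurveL : E →L[ℝ] C(I, E) :=
  LinearMap.mkContinuous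
    { toFun := fun x => ContinuousMap.const I x
      map_add' := fun _ _ => rfl
      map_smul' := fun _ _ => rfl } 1
    (fun x => by
      rw [ContinuousMap.norm_le _ (by positivity)]
      exact fun _ => (one_mul ‖x‖).ge)

@[simp] theorem constCurveL_apply (x : E) (s : I) : constCurveL E x s = x := rfl

/-- The defect of the integral equation `γ(s) = x + t ∫₀ˢ v(γ(τ)) dτ`, whose solutions are the
integral curves of `t v` on `[0, 1]` that start at `x`. -/
noncomputable def integralDefect {v : E → E} (hv : Continuous v) (z : (ℝ × E) × C(I, E)) :
    C(I, E) :=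
  z.2 - constCurveL E z.1.2 - z.1.1 • primitiveL E ((⟨v, hv⟩ : C(E, E)).comp z.2)

theorem contDiff_integralDefect {v : E → E} (hv : ContDiff ℝ ∞ v) :
    ContDiff ℝ ∞ (integralDefect hv.continuous) := by
  have h1 : ContDiff ℝ ∞ fun z : (ℝ × E) × C(I, E) =>
      primitiveL E ((⟨v, hv.continuous⟩ : C(E, E)).comp z.2) :=
    (primitiveL E).contDiff.comp ((contDiff_postcomp hv).comp contDiff_snd)
  have h2 : ContDiff ℝ ∞ fun z : (ℝ × E) × C(I, E) => constCurveL E z.1.2 :=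
    (constCurveL E).contDiff.comp contDiff_fst.snd
  exact (contDiff_snd.sub h2).sub (contDiff_fst.fst.smul h1)

theorem integralDefect_eq_zero_iff {v : E → E} (hv : Continuous v) (t : ℝ) (x : E) (γ : C(I, E)) :
    integralDefect hv ((t, x), γ) = 0 ↔
      ∀ s : I, γ s = x + t • ∫ τ in (0 : ℝ)..s, v (Set.IccExtend zero_le_one γ τ) := by
  rw [ContinuousMap.ext_iff]
  refine forall_congr' fun s => ?_
  have : integralDefect hv ((t, x), γ) s
      = γ s - x - t • ∫ τ in (0 : ℝ)..s, v (Set.IccExtend zero_le_one γ τ) := rfl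
  rw [this, ContinuousMap.zero_apply, sub_sub, sub_eq_zero]

/-- Reparametrizing an integral curve of `t v` by `u ↦ s u` gives an integral curve of `(t s) v`. -/
theorem integralDefect_rescale {v : E → E} (hv : Continuous v) {t : ℝ} {x : E} {γ : C(I, E)}
    (h : integralDefect hv ((t, x), γ) = 0) (s : I) :
    integralDefect hv ((t * s, x), γ.comp ⟨fun u : I => s * u, by fun_prop⟩) = 0 := by
  rw [integralDefect_eq_zero_iff] at h ⊢
  intro u
  have h1 : ∫ τ in (0 : ℝ)..u, v (Set.IccExtend zero_le_one
        (γ.comp ⟨fun u : I => s * u, by fun_prop⟩) τ)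
      = ∫ τ in (0 : ℝ)..u, v (Set.IccExtend zero_le_one γ (s * τ)) := by
    refine intervalIntegral.integral_congr fun τ hτ => ?_
    rw [Set.uIcc_of_le u.2.1] at hτ
    have hτ1 : τ ∈ I := ⟨hτ.1, hτ.2.trans u.2.2⟩
    have hτ2 : (s : ℝ) * τ ∈ I := unitInterval.mul_mem s.2 hτ1
    rw [Set.IccExtend_of_mem _ _ hτ1, Set.IccExtend_of_mem _ _ hτ2]
    rfl
  rw [h1, mul_smul, intervalIntegral.smul_integral_comp_mul_left
    (fun τ => v (Set.IccExtend zero_le_one γ τ)), mul_zero]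
  exact h (s * u)

variable [CompleteSpace E]

/-- A smooth vector field has a local flow that is smooth jointly in time and initial point: the
value at `s = 1` of the solution of `γ(s) = x + t ∫₀ˢ v(γ)` near the constant curve. -/
theorem exists_contDiffAt_flow {v : E → E} (hv : ContDiff ℝ ∞ v) (x₀ : E) :
    ∃ Φ : ℝ × E → E, (∀ᶠ z in 𝓝 ((0 : ℝ), x₀), ContDiffAt ℝ ∞ Φ z) ∧ (∀ᶠ x in 𝓝 x₀, Φ (0, x) = x) ∧
      ∀ᶠ z in 𝓝 ((0 : ℝ), x₀), HasDerivAt (fun t => Φ (t, z.2)) (v (Φ z)) z.1 := by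
  set w : (ℝ × E) × C(I, E) := ((0, x₀), constCurveL E x₀) with hw
  have cd := contDiff_integralDefect hv
  have cdf : ContDiffAt ℝ ∞ (integralDefect hv.continuous) w := cd.contDiffAt
  have hne : (∞ : WithTop ℕ∞) ≠ 0 := by simp
  have hzero : integralDefect hv.continuous w = 0 := by
    rw [integralDefect_eq_zero_iff]; simp
  have hinv : (fderiv ℝ (integralDefect hv.continuous) w ∘L
      .inr ℝ (ℝ × E) C(I, E)).IsInvertible := by
    have h1 : HasFDerivAt (fun γ : C(I, E) => integralDefect hv.continuous (((0 : ℝ), x₀), γ))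
        (fderiv ℝ (integralDefect hv.continuous) w ∘L .inr ℝ (ℝ × E) C(I, E))
        (constCurveL E x₀) :=
      HasFDerivAt.comp (constCurveL E x₀)
        (cdf.differentiableAt hne).hasFDerivAt (hasFDerivAt_prodMk_right _ _)
    have h2 : HasFDerivAt (fun γ : C(I, E) => integralDefect hv.continuous (((0 : ℝ), x₀), γ))
        (.id ℝ C(I, E)) (constCurveL E x₀) := by
      simp only [integralDefect, zero_smul, sub_zero]
      exact (hasFDerivAt_id _).sub_const _
    rw [h1.unique h2]
    exact ⟨ContinuousLinearEquiv.refl ℝ _, rfl⟩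
  set Γ := cdf.implicitFunction hne hinv with hΓ
  have hΓs : ∀ᶠ z in 𝓝 ((0 : ℝ), x₀), ContDiffAt ℝ ∞ Γ z :=
    eventually_contDiffAt_implicitFunction cd hne hinv
  have hΓ0 : Γ (0, x₀) = constCurveL E x₀ := cdf.implicitFunction_apply_self hne hinv
  obtain ⟨δ, hδ, huniq⟩ := Metric.eventually_nhds_iff_ball.1
    (cdf.eventually_apply_eq_iff_implicitFunction hne hinv)
  set Φ : ℝ × E → E := fun z => Γ z 1 with hΦ
  have hΦs : ∀ᶠ z in 𝓝 ((0 : ℝ), x₀), ContDiffAt ℝ ∞ Φ z := hΓs.mono fun z hz =>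
    ((ContinuousMap.evalCLM ℝ (1 : I) : C(I, E) →L[ℝ] E).contDiff.contDiffAt).comp z hz
  have hev : ∀ᶠ z in 𝓝 ((0 : ℝ), x₀), Γ z ∈ Metric.ball (constCurveL E x₀) δ ∧
      integralDefect hv.continuous (z, Γ z) = 0 ∧ ContinuousAt Φ z := by
    have a1 : ∀ᶠ z in 𝓝 ((0 : ℝ), x₀), Γ z ∈ Metric.ball (constCurveL E x₀) δ :=
      hΓs.self_of_nhds.continuousAt.eventually_mem (by rw [hΓ0]; exact Metric.ball_mem_nhds _ hδ)
    have a2 := cdf.eventually_apply_implicitFunction hne hinv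
    filter_upwards [a1, a2, hΦs] with z h1 h2 h3
    exact ⟨h1, h2.trans hzero, h3.continuousAt⟩
  obtain ⟨δ', hδ', hnear⟩ := Metric.eventually_nhds_iff_ball.1 hev
  set ρ := min δ δ' with hρ
  have hρ0 : 0 < ρ := lt_min hδ hδ'
  have hmem : ∀ t : ℝ, |t| < ρ → ∀ x ∈ Metric.ball x₀ ρ,
      (t, x) ∈ Metric.ball ((0 : ℝ), x₀) ρ := by
    intro t ht x hx
    rw [← ball_prod_same]
    exact ⟨by simpa using ht, hx⟩
  -- Uniqueness in the implicit function theorem identifies the rescaled curve.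
  have hscale : ∀ t : ℝ, |t| < ρ → ∀ x ∈ Metric.ball x₀ ρ, ∀ s : I,
      Γ (t, x) s = Φ (t * s, x) := by
    intro t ht x hx s
    obtain ⟨b1, b2, -⟩ := hnear _ (Metric.ball_subset_ball (min_le_right _ _) (hmem t ht x hx))
    have hts : |t * s| < ρ := by
      rw [abs_mul, abs_of_nonneg s.2.1]
      exact (mul_le_of_le_one_right (abs_nonneg t) s.2.2).trans_lt ht
    have hm := Metric.ball_subset_ball (min_le_left _ _) (hmem _ hts x hx)
    have hγ : (Γ (t, x)).comp ⟨fun u : I => s * u, by fun_prop⟩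
        ∈ Metric.ball (constCurveL E x₀) δ := by
      rw [mem_ball_iff_norm] at b1 ⊢
      refine lt_of_le_of_lt ?_ b1
      rw [ContinuousMap.norm_le _ (norm_nonneg _)]
      intro u
      exact (Γ (t, x) - constCurveL E x₀).norm_coe_le_norm (s * u)
    have hin : ((t * (s : ℝ), x), (Γ (t, x)).comp ⟨fun u : I => s * u, by fun_prop⟩)
        ∈ Metric.ball w δ := by
      rw [hw, ← ball_prod_same]
      exact ⟨hm, hγ⟩
    have := (huniq _ hin).1 ((integralDefect_rescale hv.continuous b2 s).trans hzero.symm)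
    have h1 := congrArg (fun η : C(I, E) => η 1) this
    simpa [hΦ, hΓ] using h1.symm
  have hcont : ∀ x ∈ Metric.ball x₀ ρ,
      ContinuousOn (fun t : ℝ => v (Φ (t, x))) (Metric.ball 0 ρ) := by
    intro x hx t ht
    have ht' : |t| < ρ := by simpa using ht
    have h3 := (hnear _ (Metric.ball_subset_ball (min_le_right _ _) (hmem t ht' x hx))).2.2
    exact ((hv.continuous.continuousAt).comp
      (h3.comp (f := fun t : ℝ => (t, x)) (by fun_prop))).continuousWithinAt
  have hint : ∀ x ∈ Metric.ball x₀ ρ, ∀ t : ℝ, |t| < ρ →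
      Φ (t, x) = x + ∫ τ in (0 : ℝ)..t, v (Φ (τ, x)) := by
    intro x hx t ht
    obtain ⟨-, b2, -⟩ := hnear _ (Metric.ball_subset_ball (min_le_right _ _) (hmem t ht x hx))
    have h1 := (integralDefect_eq_zero_iff _ _ _ _).1 b2 1
    rw [show Φ (t, x) = Γ (t, x) 1 from rfl, h1]
    congr 1
    have h2 : ∫ τ in (0 : ℝ)..((1 : I) : ℝ), v (Set.IccExtend zero_le_one (Γ (t, x)) τ)
        = ∫ τ in (0 : ℝ)..1, v (Φ (t * τ, x)) := by
      rw [Set.Icc.coe_one]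
      refine intervalIntegral.integral_congr fun τ hτ => ?_
      rw [Set.uIcc_of_le zero_le_one] at hτ
      rw [Set.IccExtend_of_mem _ _ hτ, hscale t ht x hx]
    rw [h2, intervalIntegral.smul_integral_comp_mul_left (fun τ => v (Φ (τ, x)))]
    simp
  refine ⟨Φ, hΦs, ?_, ?_⟩
  · filter_upwards [Metric.ball_mem_nhds x₀ hρ0] with x hx
    rw [hint x hx 0 (by simpa using hρ0)]
    simp
  · filter_upwards [Metric.ball_mem_nhds ((0 : ℝ), x₀) hρ0] with z hz
    rw [← ball_prod_same] at hz
    obtain ⟨hz1, hz2⟩ := hz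
    have hz1' : |z.1| < ρ := by simpa using hz1
    have hsub : Set.uIcc 0 z.1 ⊆ Metric.ball 0 ρ :=
      (convex_ball (0 : ℝ) ρ).ordConnected.uIcc_subset (Metric.mem_ball_self hρ0) hz1
    have hd : HasDerivAt (fun t => z.2 + ∫ τ in (0 : ℝ)..t, v (Φ (τ, z.2))) (v (Φ z)) z.1 :=
      (intervalIntegral.integral_hasDerivAt_right
        ((hcont _ hz2).mono hsub).intervalIntegrable
        ((hcont _ hz2).stronglyMeasurableAtFilter Metric.isOpen_ball _ hz1)
        ((hcont _ hz2).continuousAt (Metric.isOpen_ball.mem_nhds hz1))).const_add _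
    refine hd.congr_of_eventuallyEq ?_
    filter_upwards [Metric.isOpen_ball.mem_nhds hz1] with t ht
    exact hint _ hz2 t (by simpa using ht)

end Flow


/-! ### First integrals -/

section FirstIntegrals

universe u

variable {E : Type u} [NormedAddCommGroup E] [NormedSpace ℝ E] [CompleteSpace E]
  {P : Type*} [NormedAddCommGroup P] [NormedSpace ℝ P] [CompleteSpace P]

/-- Straightening: a smooth vector field has a full set of smooth first integrals near a point
where it does not vanish; `P` is the space of their values. They are the coordinates transverse to
the time in the flow box `(t, b) ↦ Φ(t, x₀ + L (0, b))`, where `L (1, 0) = v x₀`. -/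
theorem exists_firstIntegrals (L₀ : (ℝ × P) ≃L[ℝ] E) {v : E → E} (hv : ContDiff ℝ ∞ v) {x₀ : E}
    (hv₀ : v x₀ ≠ 0) :
    ∃ y : E → P, (∀ᶠ p in 𝓝 x₀, ContDiffAt ℝ ∞ y p) ∧ (∀ᶠ p in 𝓝 x₀, fderiv ℝ y p (v p) = 0) ∧
      ∀ u, fderiv ℝ y x₀ u = 0 → ∃ c : ℝ, u = c • v x₀ := by
  obtain ⟨L, hL⟩ : ∃ L : (ℝ × P) ≃L[ℝ] E, L (1, 0) = v x₀ := by
    have h0 : L₀ (1, 0) ≠ 0 := by simp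
    obtain ⟨A, hA⟩ := SeparatingDual.exists_continuousLinearEquiv_apply_eq (R := ℝ) h0 hv₀
    exact ⟨L₀.trans A, hA⟩
  obtain ⟨Φ, hΦs, hΦ0, hΦ⟩ := exists_contDiffAt_flow hv x₀
  have hne : (∞ : WithTop ℕ∞) ≠ 0 := by simp
  set j : ℝ × P → ℝ × E := fun z => (z.1, x₀ + L (0, z.2)) with hj
  have hj0 : j 0 = (0, x₀) := by
    have : L ((0 : ℝ), (0 : P)) = 0 := map_zero L
    simp [hj, this]
  have hjs : ContDiff ℝ ∞ j :=
    contDiff_fst.prodMk (contDiff_const.add (L.contDiff.comp (contDiff_const.prodMk contDiff_snd)))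
  have hjt : Filter.Tendsto j (𝓝 0) (𝓝 (0, x₀)) := hj0 ▸ hjs.continuous.tendsto 0
  set Ψ : ℝ × P → E := Φ ∘ j with hΨ
  have hΨe : ∀ᶠ z in 𝓝 (0 : ℝ × P), ContDiffAt ℝ ∞ Ψ z :=
    (hjt.eventually hΦs).mono fun z hz => ContDiffAt.comp z hz hjs.contDiffAt
  have hΨs : ContDiffAt ℝ ∞ Ψ 0 := hΨe.self_of_nhds
  have hΨ0 : Ψ 0 = x₀ := by
    simp only [hΨ, Function.comp, hj0]
    exact hΦ0.self_of_nhds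
  have hL' : HasFDerivAt Ψ (L : (ℝ × P) →L[ℝ] E) 0 := by
    have hD := (hΨs.differentiableAt hne).hasFDerivAt
    have h1 : HasFDerivAt (fun t : ℝ => Ψ (t, 0)) (fderiv ℝ Ψ 0 ∘L .inl ℝ ℝ P) 0 :=
      HasFDerivAt.comp (0 : ℝ) (g := Ψ) hD (hasFDerivAt_prodMk_left (0 : ℝ) (0 : P))
    have h1' : HasDerivAt (fun t : ℝ => Ψ (t, 0)) (v x₀) 0 := by
      have := hΦ.self_of_nhds
      have h0 : Φ (0, x₀) = x₀ := hΦ0.self_of_nhds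
      simp only [h0] at this
      have hl : L ((0 : ℝ), (0 : P)) = 0 := map_zero L
      simpa [hΨ, hj, hl] using this
    have h2 : HasFDerivAt (fun b : P => Ψ (0, b)) (fderiv ℝ Ψ 0 ∘L .inr ℝ ℝ P) 0 :=
      HasFDerivAt.comp (0 : P) (g := Ψ) hD (hasFDerivAt_prodMk_right (0 : ℝ) (0 : P))
    have h2' : HasFDerivAt (fun b : P => Ψ (0, b)) ((L : (ℝ × P) →L[ℝ] E) ∘L .inr ℝ ℝ P) 0 := by
      have h3 : HasFDerivAt (fun b : P => x₀ + ((L : (ℝ × P) →L[ℝ] E) ∘L .inr ℝ ℝ P) b)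
          ((L : (ℝ × P) →L[ℝ] E) ∘L .inr ℝ ℝ P) 0 :=
        (ContinuousLinearMap.hasFDerivAt _).const_add _
      refine h3.congr_of_eventuallyEq ?_
      have hc : Filter.Tendsto (fun b : P => x₀ + L ((0 : ℝ), b)) (𝓝 0) (𝓝 x₀) := by
        have hcc : Continuous fun b : P => x₀ + L ((0 : ℝ), b) := by fun_prop
        have hl : L ((0 : ℝ), (0 : P)) = 0 := map_zero L
        simpa [hl] using hcc.tendsto 0
      filter_upwards [hc.eventually hΦ0] with b hb
      exact hb
    have e1 := congrArg (fun A : ℝ →L[ℝ] E => A 1) (h1.unique h1'.hasFDerivAt)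
    have e2 := h2.unique h2'
    have : fderiv ℝ Ψ 0 = (L : (ℝ × P) →L[ℝ] E) := by
      ext z
      · simpa [hL] using e1
      · simpa using congrArg (fun A : P →L[ℝ] E => A z) e2
    rwa [this] at hD
  set e := hΨs.toOpenPartialHomeomorph Ψ hL' hne with he
  have heΨ : (e : ℝ × P → E) = Ψ := hΨs.toOpenPartialHomeomorph_coe hL' hne
  have h0s : (0 : ℝ × P) ∈ e.source := hΨs.mem_toOpenPartialHomeomorph_source hL' hne
  have hxt : x₀ ∈ e.target := by
    have := e.map_source h0s
    rwa [heΨ, hΨ0] at this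
  have hinv0 : e.symm x₀ = 0 := by
    rw [← hΨ0, ← heΨ]; exact e.left_inv h0s
  have hes : ∀ᶠ p in 𝓝 x₀, ContDiffAt ℝ ∞ e.symm p := by
    have := eventually_contDiffAt_symm hΨe hL' e heΨ h0s
    rwa [hΨ0] at this
  set y : E → P := fun p => (e.symm p).2 with hy
  have hys : ∀ᶠ p in 𝓝 x₀, ContDiffAt ℝ ∞ y p := hes.mono fun p hp => contDiffAt_snd.comp p hp
  have hyd : ∀ᶠ p in 𝓝 x₀, DifferentiableAt ℝ y p := hys.mono fun p hp => hp.differentiableAt hne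
  have hyΨ : ∀ z ∈ e.source, y (Ψ z) = z.2 := by
    intro z hz
    rw [← heΨ, hy]
    simp only
    rw [e.left_inv hz]
  refine ⟨y, hys, ?_, ?_⟩
  · have hflow : ∀ᶠ z in 𝓝 (0 : ℝ × P),
        HasDerivAt (fun t => Ψ (t, z.2)) (v (Ψ z)) z.1 := hjt.eventually hΦ
    have ht : Filter.Tendsto e.symm (𝓝 x₀) (𝓝 0) := by
      have := e.continuousAt_symm hxt
      rwa [ContinuousAt, hinv0] at this
    filter_upwards [ht.eventually hflow, hyd, e.open_target.mem_nhds hxt] with p hp1 hp2 hp3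
    have hz := e.map_target hp3
    have hpe : Ψ (e.symm p) = p := by rw [← heΨ]; exact e.right_inv hp3
    rw [hpe] at hp1
    have hp2' : HasFDerivAt y (fderiv ℝ y p) (Ψ ((e.symm p).1, (e.symm p).2)) := by
      rw [Prod.mk.eta, hpe]; exact hp2.hasFDerivAt
    have hc : HasDerivAt (fun t => y (Ψ (t, (e.symm p).2))) (fderiv ℝ y p (v p)) (e.symm p).1 :=
      HasFDerivAt.comp_hasDerivAt (f := fun t => Ψ (t, (e.symm p).2)) (e.symm p).1 hp2' hp1
    have hconst : (fun t => y (Ψ (t, (e.symm p).2))) =ᶠ[𝓝 (e.symm p).1]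
        fun _ => (e.symm p).2 := by
      have hcont : Continuous fun t : ℝ => (t, (e.symm p).2) := by fun_prop
      filter_upwards [hcont.continuousAt.eventually_mem (e.open_source.mem_nhds hz)] with t ht
      exact hyΨ _ ht
    exact hc.unique ((hasDerivAt_const _ _).congr_of_eventuallyEq hconst)
  · intro u hu
    have hyd0 : HasFDerivAt y (fderiv ℝ y x₀) (Ψ 0) := by
      rw [hΨ0]; exact hyd.self_of_nhds.hasFDerivAt
    have hc := hyd0.comp (0 : ℝ × P) hL'
    have hsnd : HasFDerivAt (y ∘ Ψ) (ContinuousLinearMap.snd ℝ ℝ P) 0 := by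
      refine hasFDerivAt_snd.congr_of_eventuallyEq ?_
      filter_upwards [e.open_source.mem_nhds h0s] with z hz
      exact hyΨ z hz
    have hz : (L.symm u).2 = 0 := by
      have h := congrArg (fun A : ℝ × P →L[ℝ] P => A (L.symm u)) (hc.unique hsnd)
      simp [hu] at h
      exact h.symm
    refine ⟨(L.symm u).1, ?_⟩
    rw [← hL, ← map_smul, ← L.symm_apply_eq, Prod.smul_mk]
    exact Prod.ext (by simp) (by simp [hz])

end FirstIntegrals


/-! ### Vector fields in smooth coordinates -/

section Coordinates

variable {E : Type*} [NormedAddCommGroup E] [NormedSpace ℝ E]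
  {H : Type*} [TopologicalSpace H] {I : ModelWithCorners ℝ E H}
  {M : Type*} [TopologicalSpace M] [ChartedSpace H M]
  {F : Type*} [NormedAddCommGroup F] [NormedSpace ℝ F]

theorem mvfderiv_congr {h k : M → F} {p : M} (hk : h =ᶠ[𝓝 p] k) (v : TangentSpace I p) :
    mvfderiv I h p v = mvfderiv I k p v :=
  congrArg (fun A : E →L[ℝ] F => A v) hk.mfderiv_eq

variable (I) in
/-- `φ` is a smooth coordinate system on the open set `φ.source`, with values in `F`. -/
structure IsSmoothCoord (φ : OpenPartialHomeomorph M F) : Prop where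
  contMDiffOn : ContMDiffOn I 𝓘(ℝ, F) ∞ φ φ.source
  contMDiffOn_symm : ContMDiffOn 𝓘(ℝ, F) I ∞ φ.symm φ.target

variable (I) in
/-- The vector field on `φ.source` whose expression in the coordinates `φ` is `W`. Its values
outside `φ.source` are irrelevant. -/
noncomputable def coordField (φ : OpenPartialHomeomorph M F) (W : F → F) :
    Π p : M, TangentSpace I p :=
  mpullback I 𝓘(ℝ, F) φ W

namespace IsSmoothCoord

variable {φ : OpenPartialHomeomorph M F} (hφ : IsSmoothCoord I φ) {p : M} (hp : p ∈ φ.source)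

include hφ

theorem mdifferentiable : φ.MDifferentiable I 𝓘(ℝ, F) :=
  ⟨hφ.contMDiffOn.mdifferentiableOn (by simp), hφ.contMDiffOn_symm.mdifferentiableOn (by simp)⟩

include hp

theorem contMDiffAt : ContMDiffAt I 𝓘(ℝ, F) ∞ φ p :=
  hφ.contMDiffOn.contMDiffAt (φ.open_source.mem_nhds hp)

theorem mdifferentiableAt : MDifferentiableAt I 𝓘(ℝ, F) φ p :=
  hφ.mdifferentiable.mdifferentiableAt hp

theorem isInvertible : (mfderiv I 𝓘(ℝ, F) φ p).IsInvertible :=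
  ⟨hφ.mdifferentiable.mfderiv hp, rfl⟩

theorem mvfderiv_coordField (W : F → F) : mvfderiv I φ p (coordField I φ W p) = W (φ p) :=
  congrArg (fun A => A (W (φ p))) (hφ.isInvertible hp).self_comp_inverse

theorem coordField_mvfderiv (v : TangentSpace I p) :
    coordField I φ (fun _ => mvfderiv I φ p v) p = v :=
  congrArg (fun A => A v) (hφ.isInvertible hp).inverse_comp_self

theorem coordField_eq_iff {W : F → F} {v : TangentSpace I p} :
    coordField I φ W p = v ↔ mvfderiv I φ p v = W (φ p) := by
  constructor
  · rintro rfl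
    exact hφ.mvfderiv_coordField hp W
  · intro h
    rw [← hφ.coordField_mvfderiv hp v, h]
    rfl

theorem mvfderiv_comp {F' : Type*} [NormedAddCommGroup F'] [NormedSpace ℝ F'] {G : F → F'}
    (hG : DifferentiableAt ℝ G (φ p)) (v : TangentSpace I p) :
    mvfderiv I (fun q => G (φ q)) p v = fderiv ℝ G (φ p) (mvfderiv I φ p v) := by
  have := mfderiv_comp_apply (I := I) (I' := 𝓘(ℝ, F)) (I'' := 𝓘(ℝ, F')) p
    hG.mdifferentiableAt (hφ.mdifferentiableAt hp) v
  rw [mfderiv_eq_fderiv] at this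
  exact this

variable [IsManifold I ∞ M] [CompleteSpace E]

theorem contMDiffAt_coordField {W : F → F} (hW : ContDiffAt ℝ ∞ W (φ p)) :
    ContMDiffAt I I.tangent ∞ (T% (coordField I φ W)) p := by
  have : IsManifold I 1 M := IsManifold.of_le (n := ∞) (by exact_mod_cast le_top)
  exact ContMDiffAt.mpullback_vectorField_preimage (contMDiffAt_vectorSpace_iff_contDiffAt.2 hW)
    (hφ.contMDiffAt hp) (hφ.isInvertible hp) le_rfl

theorem mdifferentiableAt_coordField {W : F → F} (hW : ContDiffAt ℝ ∞ W (φ p)) :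
    MDiffAt (T% (coordField I φ W)) p :=
  (hφ.contMDiffAt_coordField hp hW).mdifferentiableAt (by simp)

theorem mlieBracket_coordField {W₁ W₂ : F → F} (h₁ : ContDiffAt ℝ ∞ W₁ (φ p))
    (h₂ : ContDiffAt ℝ ∞ W₂ (φ p)) :
    mlieBracket I (coordField I φ W₁) (coordField I φ W₂) p
      = coordField I φ (lieBracket ℝ W₁ W₂) p := by
  have h2 : minSmoothness ℝ 2 ≤ (∞ : WithTop ℕ∞) := by
    rw [minSmoothness_of_isRCLikeNormedField]
    exact WithTop.coe_le_coe.2 (le_top : (2 : ℕ∞) ≤ ⊤)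
  have : IsManifold I (minSmoothness ℝ 2) M := IsManifold.of_le (n := ∞) h2
  have key := mpullback_mlieBracket (I := I) (I' := 𝓘(ℝ, F)) (V := W₁) (W := W₂) (x₀ := p)
    ((contMDiffAt_vectorSpace_iff_contDiffAt.2 h₁).mdifferentiableAt (by simp))
    ((contMDiffAt_vectorSpace_iff_contDiffAt.2 h₂).mdifferentiableAt (by simp))
    (hφ.contMDiffAt hp) h2
  have h3 : mlieBracket 𝓘(ℝ, F) W₁ W₂ = lieBracket ℝ W₁ W₂ :=
    (mlieBracketWithin_eq_lieBracketWithin (s := Set.univ)).trans lieBracketWithin_univ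
  rw [h3] at key
  exact key.symm

theorem contDiffAt_comp_symm {h : M → ℝ} (hh : ContMDiffAt I 𝓘(ℝ, ℝ) ∞ h p) :
    ContDiffAt ℝ ∞ (fun z => h (φ.symm z)) (φ p) := by
  rw [← contMDiffAt_iff_contDiffAt]
  have h1 : ContMDiffAt 𝓘(ℝ, F) I ∞ φ.symm (φ p) :=
    hφ.contMDiffOn_symm.contMDiffAt (φ.open_target.mem_nhds (φ.map_source hp))
  refine ContMDiffAt.comp (φ p) (g := h) ?_ h1
  rwa [φ.left_inv hp]

theorem mvfderiv_eq_fderiv_comp_symm {h : M → ℝ} (hh : ContMDiffAt I 𝓘(ℝ, ℝ) ∞ h p)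
    (v : TangentSpace I p) :
    mvfderiv I h p v = fderiv ℝ (fun z => h (φ.symm z)) (φ p) (mvfderiv I φ p v) := by
  rw [← hφ.mvfderiv_comp hp ((hφ.contDiffAt_comp_symm hp hh).differentiableAt (by simp))]
  refine mvfderiv_congr ?_ v
  filter_upwards [φ.open_source.mem_nhds hp] with q hq
  rw [φ.left_inv hq]

end IsSmoothCoord

end Coordinates


/-! ### The radial field of a cone -/

section RadialField

variable {E : Type*} [NormedAddCommGroup E] [NormedSpace ℝ E]
  {H : Type*} [TopologicalSpace H] {I : ModelWithCorners ℝ E H}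
  {M : Type*} [TopologicalSpace M] [ChartedSpace H M]
  [RiemannianBundle (fun p : M => TangentSpace I p)]
  [FiniteDimensional ℝ E] [IsManifold I ∞ M]
  [IsContMDiffRiemannianBundle I ∞ E (fun p : M => TangentSpace I p)]

theorem contMDiffAt_inner {Y Z : Π p : M, TangentSpace I p} {p : M}
    (hY : ContMDiffAt I I.tangent ∞ (T% Y) p) (hZ : ContMDiffAt I I.tangent ∞ (T% Z) p) :
    ContMDiffAt I 𝓘(ℝ, ℝ) ∞ (fun q : M => (inner ℝ (Y q) (Z q) : ℝ)) p :=
  ContMDiffAt.inner_bundle (IB := I) (F := E) (E := fun p : M => TangentSpace I p)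
    (b := fun q : M => q) hY hZ

/-- The coordinate expression of `-r ∂/∂r`. -/
def radial (P : Type*) [Zero P] (z : ℝ × P) : ℝ × P := (-z.1, 0)

variable {P : Type*} [NormedAddCommGroup P] [NormedSpace ℝ P]

theorem hasFDerivAt_radial (z : ℝ × P) :
    HasFDerivAt (radial P) ((-(ContinuousLinearMap.fst ℝ ℝ P)).prod 0) z :=
  (hasFDerivAt_fst.neg).prodMk (hasFDerivAt_const 0 z)

theorem contDiff_radial : ContDiff ℝ ∞ (radial P) :=
  contDiff_fst.neg.prodMk contDiff_const

theorem lieBracket_const_radial (b : ℝ × P) :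
    lieBracket ℝ (fun _ => b) (radial P) = fun _ => (-b.1, 0) := by
  ext1 z
  simp [lieBracket_eq, (hasFDerivAt_radial z).fderiv]

theorem lieBracket_const_const (b b' : ℝ × P) :
    lieBracket ℝ (fun _ : ℝ × P => b) (fun _ => b') = fun _ => 0 := by
  ext1 z
  simp [lieBracket_eq]

/-- Restricting to the line through `z` in the radial direction. -/
theorem hasDerivAt_radial_line {G : ℝ × P → ℝ} {z : ℝ × P} (hG : DifferentiableAt ℝ G z) :
    HasDerivAt (fun t => G (t, z.2)) (fderiv ℝ G z (1, 0)) z.1 := by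
  have h1 : HasDerivAt (fun t : ℝ => (t, z.2)) ((1 : ℝ), (0 : P)) z.1 :=
    (hasDerivAt_id _).prodMk (hasDerivAt_const _ _)
  exact HasFDerivAt.comp_hasDerivAt (f := fun t : ℝ => (t, z.2)) z.1
    (by rw [Prod.mk.eta]; exact hG.hasFDerivAt) h1

variable {φ : OpenPartialHomeomorph M (ℝ × P)} (hφ : IsSmoothCoord I φ)

include hφ

/-- If the metric is `dr² + r² f` with `f` not depending on `r`, then `V = -r ∂/∂r` satisfies
`⟨∇_v V, w⟩ = -⟨v, w⟩`, as the Koszul formula shows for coordinate fields. -/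
theorem leviCivita_radial {f : P → P → P → ℝ}
    (hg : ∀ p ∈ φ.source, ∀ v w : TangentSpace I p,
      inner ℝ v w = (mvfderiv I φ p v).1 * (mvfderiv I φ p w).1
        + (φ p).1 ^ 2 * f (φ p).2 (mvfderiv I φ p v).2 (mvfderiv I φ p w).2)
    (hf0 : ∀ y b, f y 0 b = 0) {p : M} (hp : p ∈ φ.source) (v : TangentSpace I p) :
    leviCivita I M (coordField I φ (radial P)) p v = -v := by
  have : CompleteSpace E := FiniteDimensional.complete ℝ E
  set V := coordField I φ (radial P) with hV
  have hVs : ContMDiffAt I I.tangent ∞ (T% V) p :=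
    hφ.contMDiffAt_coordField hp contDiff_radial.contDiffAt
  have hC : ∀ b : ℝ × P, ContMDiffAt I I.tangent ∞ (T% (coordField I φ fun _ => b)) p :=
    fun b => hφ.contMDiffAt_coordField hp contDiffAt_const
  have hVb : ∀ q ∈ φ.source, ∀ w : TangentSpace I q,
      inner ℝ (V q) w = -(φ q).1 * (mvfderiv I φ q w).1 := by
    intro q hq w
    rw [hg q hq, hφ.mvfderiv_coordField hq]
    simp [radial, hf0]
  refine ext_inner_right ℝ fun w => ?_
  set b := mvfderiv I φ p v with hb
  set b' := mvfderiv I φ p w with hb'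
  set X := coordField I φ (fun _ => b) with hX
  set Z := coordField I φ (fun _ => b') with hZ
  have hXp : X p = v := hφ.coordField_mvfderiv hp v
  have hZp : Z p = w := hφ.coordField_mvfderiv hp w
  have hXq : ∀ q ∈ φ.source, mvfderiv I φ q (X q) = b := fun q hq => hφ.mvfderiv_coordField hq _
  have hZq : ∀ q ∈ φ.source, mvfderiv I φ q (Z q) = b' := fun q hq => hφ.mvfderiv_coordField hq _
  have hsrc := φ.open_source.mem_nhds hp
  have hlin : ∀ c : ℝ, ∀ u : TangentSpace I p,
      mvfderiv I (fun q => -(φ q).1 * c) p u = -(mvfderiv I φ p u).1 * c := by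
    intro c u
    have hd : HasFDerivAt (fun z : ℝ × P => -z.1 * c)
        (c • -(ContinuousLinearMap.fst ℝ ℝ P)) (φ p) :=
      hasFDerivAt_fst.neg.mul_const c
    rw [hφ.mvfderiv_comp (G := fun z : ℝ × P => -z.1 * c) hp hd.differentiableAt, hd.fderiv]
    simp [mul_comm]
  have t1 : mvfderiv I (fun q => inner ℝ (V q) (Z q)) p (X p) = -b.1 * b'.1 := by
    rw [mvfderiv_congr (k := fun q => -(φ q).1 * b'.1), hlin, hXq p hp]
    filter_upwards [hsrc] with q hq
    rw [hVb q hq, hZq q hq]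
  have t2 : mvfderiv I (fun q => inner ℝ (X q) (V q)) p (Z p) = -b'.1 * b.1 := by
    rw [mvfderiv_congr (k := fun q => -(φ q).1 * b.1), hlin, hZq p hp]
    filter_upwards [hsrc] with q hq
    rw [real_inner_comm, hVb q hq, hXq q hq]
  have t3 : mvfderiv I (fun q => inner ℝ (Z q) (X q)) p (V p)
      = -2 * (φ p).1 ^ 2 * f (φ p).2 b'.2 b.2 := by
    have hs := contMDiffAt_inner (hC b') (hC b)
    rw [hφ.mvfderiv_eq_fderiv_comp_symm hp hs, hφ.mvfderiv_coordField hp]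
    set G : ℝ × P → ℝ := fun z => inner ℝ (Z (φ.symm z)) (X (φ.symm z)) with hG
    have hGd : DifferentiableAt ℝ G (φ p) :=
      (hφ.contDiffAt_comp_symm hp hs).differentiableAt (by simp)
    have hGf : ∀ z ∈ φ.target, G z = b'.1 * b.1 + z.1 ^ 2 * f z.2 b'.2 b.2 := by
      intro z hz
      have hq := φ.map_target hz
      simp only [hG]
      rw [hg _ hq, hXq _ hq, hZq _ hq, φ.right_inv hz]
    have hd1 := hasDerivAt_radial_line hGd
    have hd2 : HasDerivAt (fun t => G (t, (φ p).2)) (2 * (φ p).1 * f (φ p).2 b'.2 b.2) (φ p).1 := by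
      have h0 : HasDerivAt (fun t : ℝ => b'.1 * b.1 + t ^ 2 * f (φ p).2 b'.2 b.2)
          (2 * (φ p).1 * f (φ p).2 b'.2 b.2) (φ p).1 := by
        simpa using ((hasDerivAt_pow 2 (φ p).1).mul_const (f (φ p).2 b'.2 b.2)).const_add
          (b'.1 * b.1)
      refine h0.congr_of_eventuallyEq ?_
      have hcont : Continuous fun t : ℝ => (t, (φ p).2) := by fun_prop
      filter_upwards [hcont.continuousAt.eventually_mem
        (φ.open_target.mem_nhds (φ.map_source hp))] with t ht
      exact hGf _ ht
    have hr : radial P (φ p) = (-(φ p).1) • ((1 : ℝ), (0 : P)) := by simp [radial]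
    rw [hr, map_smul, hd1.unique hd2, smul_eq_mul]
    ring
  have hbr : ∀ c : ℝ × P, ∀ u : TangentSpace I p,
      inner ℝ (mlieBracket I (coordField I φ fun _ => c) V p) u
        = -c.1 * (mvfderiv I φ p u).1 := by
    intro c u
    rw [hV, hφ.mlieBracket_coordField hp contDiffAt_const contDiff_radial.contDiffAt,
      lieBracket_const_radial, hg p hp, hφ.mvfderiv_coordField hp]
    simp [hf0]
  have t4 : inner ℝ (mlieBracket I X V p) (Z p) = -b.1 * b'.1 := by rw [hbr, hZq p hp]
  have t5 : inner ℝ (mlieBracket I X Z p) (V p) = 0 := by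
    rw [hX, hZ, hφ.mlieBracket_coordField hp contDiffAt_const contDiffAt_const,
      lieBracket_const_const, real_inner_comm, hVb p hp, hφ.mvfderiv_coordField hp]
    simp
  have t6 : inner ℝ (mlieBracket I V Z p) (X p) = b'.1 * b.1 := by
    rw [mlieBracket_swap_apply, inner_neg_left, hbr, hXq p hp]
    ring
  have key := inner_leviCivita ((hC b).mdifferentiableAt (by simp))
    (hVs.mdifferentiableAt (by simp)) ((hC b').mdifferentiableAt (by simp))
  have hXZ : inner ℝ v w = b'.1 * b.1 + (φ p).1 ^ 2 * f (φ p).2 b'.2 b.2 := by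
    rw [real_inner_comm, hg p hp]
  rw [koszul] at key
  change inner ℝ (leviCivita I M V p (X p)) (Z p) = 1 / 2 *
    (mvfderiv I (fun q => inner ℝ (V q) (Z q)) p (X p)
      + mvfderiv I (fun q => inner ℝ (Z q) (X q)) p (V p)
      - mvfderiv I (fun q => inner ℝ (X q) (V q)) p (Z p)
      + inner ℝ (mlieBracket I X V p) (Z p)
      - inner ℝ (mlieBracket I X Z p) (V p)
      - inner ℝ (mlieBracket I V Z p) (X p)) at key
  rw [t1, t2, t3, t4, t5, t6, hXp, hZp] at key
  rw [key, inner_neg_left, hXZ]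
  ring

end RadialField


/-! ### Coordinates adapted to a vector field -/

section AdaptedCoordinates

universe u

/-- A map that is smooth near a point agrees near it with a globally smooth map. -/
theorem exists_contDiff_eventuallyEq {F G : Type*} [NormedAddCommGroup F] [NormedSpace ℝ F]
    [FiniteDimensional ℝ F] [NormedAddCommGroup G] [NormedSpace ℝ G] {g : F → G} {z₀ : F}
    (hg : ∀ᶠ z in 𝓝 z₀, ContDiffAt ℝ ∞ g z) :
    ∃ g' : F → G, ContDiff ℝ ∞ g' ∧ g' =ᶠ[𝓝 z₀] g := by
  obtain ⟨ρ, hρ, hball⟩ := Metric.eventually_nhds_iff_ball.1 hg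
  let χ : ContDiffBump z₀ := ⟨ρ / 4, ρ / 2, by positivity, by linarith⟩
  refine ⟨fun z => χ z • g z, contDiff_iff_contDiffAt.2 fun z => ?_, ?_⟩
  · by_cases hz : z ∈ tsupport χ
    · rw [χ.tsupport_eq] at hz
      exact χ.contDiffAt.smul (hball z (Metric.closedBall_subset_ball (half_lt_self hρ) hz))
    · refine (contDiffAt_const (c := (0 : G))).congr_of_eventuallyEq ?_
      filter_upwards [(isClosed_tsupport χ).isOpen_compl.mem_nhds hz] with w hw
      rw [image_eq_zero_of_notMem_tsupport hw, zero_smul]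
  · filter_upwards [χ.eventuallyEq_one] with z hz
    rw [hz, Pi.one_apply, one_smul]

variable {E : Type*} [NormedAddCommGroup E] [NormedSpace ℝ E] [FiniteDimensional ℝ E]
  {H : Type*} [TopologicalSpace H] {I : ModelWithCorners ℝ E H}
  {M : Type*} [TopologicalSpace M] [ChartedSpace H M] [IsManifold I ∞ M]
  {F : Type u} [NormedAddCommGroup F] [NormedSpace ℝ F] [FiniteDimensional ℝ F]
  {P : Type*} [NormedAddCommGroup P] [NormedSpace ℝ P] [FiniteDimensional ℝ P]

/-- The expression of a smooth vector field in smooth coordinates is smooth. -/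
theorem IsSmoothCoord.contDiffAt_coordExpr {c : OpenPartialHomeomorph M F}
    (hc : IsSmoothCoord I c) {V : Π p : M, TangentSpace I p} {z : F} (hz : z ∈ c.target)
    (hV : ContMDiffAt I I.tangent ∞ (T% V) (c.symm z)) :
    ContDiffAt ℝ ∞ (fun z => mvfderiv I c (c.symm z) (V (c.symm z))) z := by
  have : CompleteSpace F := FiniteDimensional.complete ℝ F
  have : IsManifold I 1 M := IsManifold.of_le (n := ∞) (by exact_mod_cast le_top)
  have hd := hc.mdifferentiable
  have hinv : ∀ w ∈ c.target, (mfderiv 𝓘(ℝ, F) I c.symm w).IsInvertible :=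
    fun w hw => ⟨hd.symm.mfderiv hw, rfl⟩
  have hs : ContMDiffAt 𝓘(ℝ, F) I ∞ c.symm z :=
    hc.contMDiffOn_symm.contMDiffAt (c.open_target.mem_nhds hz)
  have key : ContDiffAt ℝ ∞ (mpullback 𝓘(ℝ, F) I c.symm V) z :=
    contMDiffAt_vectorSpace_iff_contDiffAt.1
      (ContMDiffAt.mpullback_vectorField_preimage hV hs (hinv z hz) le_rfl)
  refine key.congr_of_eventuallyEq ?_
  filter_upwards [c.open_target.mem_nhds hz] with w hw
  have h1 : mfderiv 𝓘(ℝ, F) I c.symm w (mpullback 𝓘(ℝ, F) I c.symm V w) = V (c.symm w) :=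
    congrArg (fun A => A (V (c.symm w))) (hinv w hw).self_comp_inverse
  have h2 := congrArg (fun A => A (mpullback 𝓘(ℝ, F) I c.symm V w)) (hd.comp_symm_deriv hw)
  rw [← h1]
  exact h2

/-- If `V r = -r` and `r ≠ 0` at `x`, then `r` can be completed by first integrals of `V` to
coordinates near `x` in which `V = -r ∂/∂r`. The range of the coordinates can be taken to be a
ball. -/
theorem exists_adaptedCoord (L₀ : (ℝ × P) ≃L[ℝ] F) {c : OpenPartialHomeomorph M F}
    (hc : IsSmoothCoord I c) {x : M} (hxc : x ∈ c.source) {V : Π p : M, TangentSpace I p}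
    {U : Set M} (hU : IsOpen U) (hxU : x ∈ U) (hV : IsSmoothFieldOn V U) {r : M → ℝ}
    (hr : ∀ p ∈ U, ContMDiffAt I 𝓘(ℝ, ℝ) ∞ r p) (hrV : ∀ p ∈ U, mvfderiv I r p (V p) = -r p)
    (hrx : r x ≠ 0) :
    ∃ (φ : OpenPartialHomeomorph M (ℝ × P)) (ρ : ℝ), IsSmoothCoord I φ ∧ x ∈ φ.source ∧
      φ.source ⊆ U ∧ φ.target = Metric.ball (φ x) ρ ∧
      (∀ p ∈ φ.source, (φ p).1 = r p) ∧
      ∀ p ∈ φ.source, mvfderiv I φ p (V p) = radial P (φ p) := by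
  have : CompleteSpace F := FiniteDimensional.complete ℝ F
  have : CompleteSpace P := FiniteDimensional.complete ℝ P
  have hne : (∞ : WithTop ℕ∞) ≠ 0 := by simp
  have hVat : ∀ p ∈ U, ContMDiffAt I I.tangent ∞ (T% V) p :=
    fun p hp => hV.contMDiffAt (hU.mem_nhds hp)
  set z₀ := c x with hz₀
  have hz₀t : z₀ ∈ c.target := c.map_source hxc
  have hsymm : Filter.Tendsto c.symm (𝓝 z₀) (𝓝 x) := by
    have := c.continuousAt_symm hz₀t
    rwa [ContinuousAt, hz₀, c.left_inv hxc] at this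
  set v₀ : F → F := fun z => mvfderiv I c (c.symm z) (V (c.symm z)) with hv₀
  have hv₀c : ∀ p ∈ c.source, v₀ (c p) = mvfderiv I c p (V p) := by
    intro p hp
    have : ∀ q, q = p → mvfderiv I c q (V q) = mvfderiv I c p (V p) := by rintro _ rfl; rfl
    exact this _ (c.left_inv hp)
  have hgood : ∀ᶠ z in 𝓝 z₀, z ∈ c.target ∧ c.symm z ∈ U :=
    (c.open_target.eventually_mem hz₀t).and (hsymm.eventually_mem (hU.mem_nhds hxU))
  obtain ⟨v, hvs, hvv⟩ := exists_contDiff_eventuallyEq (g := v₀) (z₀ := z₀)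
    (hgood.mono fun z hz => hc.contDiffAt_coordExpr hz.1 (hVat _ hz.2))
  set R : F → ℝ := fun z => r (c.symm z) with hR
  have hRs : ∀ p ∈ c.source, p ∈ U → ContDiffAt ℝ ∞ R (c p) :=
    fun p hp hpU => hc.contDiffAt_comp_symm hp (hr p hpU)
  have hRV : ∀ p ∈ c.source, p ∈ U → fderiv ℝ R (c p) (mvfderiv I c p (V p)) = -r p := by
    intro p hp hpU
    rw [← hc.mvfderiv_eq_fderiv_comp_symm hp (hr p hpU), hrV p hpU]
  have hvz₀ : v z₀ = mvfderiv I c x (V x) := hvv.self_of_nhds.trans (hv₀c x hxc)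
  have hvne : v z₀ ≠ 0 := by
    intro h0
    have := hRV x hxc hxU
    rw [← hvz₀, h0, map_zero] at this
    exact hrx (by linarith)
  obtain ⟨y, hys, hyV, hyker⟩ := exists_firstIntegrals L₀ hvs hvne
  set g : F → ℝ × P := fun z => (R z, y z) with hg
  have hRe : ∀ᶠ z in 𝓝 z₀, ContDiffAt ℝ ∞ R z := hgood.mono fun z hz => by
    have := hRs _ (c.map_target hz.1) hz.2
    rwa [c.right_inv hz.1] at this
  have hgs : ∀ᶠ z in 𝓝 z₀, ContDiffAt ℝ ∞ g z :=
    (hRe.and hys).mono fun z hz => hz.1.prodMk hz.2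
  have hgd : ∀ z, ContDiffAt ℝ ∞ R z → ContDiffAt ℝ ∞ y z →
      HasFDerivAt g ((fderiv ℝ R z).prod (fderiv ℝ y z)) z := fun z h1 h2 =>
    (h1.differentiableAt hne).hasFDerivAt.prodMk (h2.differentiableAt hne).hasFDerivAt
  -- The derivative of `g` is injective, as the field spans the kernel of that of `y`.
  set A : F →L[ℝ] ℝ × P := (fderiv ℝ R z₀).prod (fderiv ℝ y z₀) with hA
  have hAinj : Function.Injective A := by
    rw [injective_iff_map_eq_zero]
    intro u hu
    have hu1 : fderiv ℝ R z₀ u = 0 := congrArg Prod.fst hu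
    have hu2 : fderiv ℝ y z₀ u = 0 := congrArg Prod.snd hu
    obtain ⟨k, hk⟩ := hyker u hu2
    rw [hk, map_smul, hvz₀, hRV x hxc hxU, smul_eq_mul] at hu1
    have hk0 : k = 0 := by
      rcases mul_eq_zero.1 hu1 with h | h
      · exact h
      · exact absurd (neg_eq_zero.1 h) hrx
    rw [hk, hk0, zero_smul]
  let L : F ≃L[ℝ] ℝ × P := (LinearEquiv.ofInjectiveOfFinrankEq (A : F →ₗ[ℝ] ℝ × P) hAinj
    L₀.symm.toLinearEquiv.finrank_eq).toContinuousLinearEquiv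
  have hL : HasFDerivAt g (L : F →L[ℝ] ℝ × P) z₀ := by
    have : (L : F →L[ℝ] ℝ × P) = A := by ext u <;> rfl
    rw [this]
    exact hgd z₀ hRe.self_of_nhds hys.self_of_nhds
  have hgz₀ : ContDiffAt ℝ ∞ g z₀ := hgs.self_of_nhds
  set e := hgz₀.toOpenPartialHomeomorph g hL hne with he
  have heg : (e : F → ℝ × P) = g := hgz₀.toOpenPartialHomeomorph_coe hL hne
  have hz₀e : z₀ ∈ e.source := hgz₀.mem_toOpenPartialHomeomorph_source hL hne
  have hesymm := eventually_contDiffAt_symm hgs hL e heg hz₀e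
  set ψ := c.trans e with hψ
  have hxψ : x ∈ ψ.source := by
    rw [hψ, OpenPartialHomeomorph.trans_source]; exact ⟨hxc, hz₀e⟩
  have hψx : ψ x = g z₀ := by rw [← heg]; rfl
  have hψt : ψ x ∈ ψ.target := ψ.map_source hxψ
  have hcψ : Filter.Tendsto (fun w => c (ψ.symm w)) (𝓝 (ψ x)) (𝓝 z₀) := by
    have h1 := ψ.continuousAt_symm hψt
    rw [ContinuousAt, ψ.left_inv hxψ] at h1
    exact (c.continuousAt hxc).tendsto.comp h1
  have hall : ∀ᶠ w in 𝓝 (ψ x), w ∈ ψ.target ∧ ContDiffAt ℝ ∞ e.symm w ∧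
      c (ψ.symm w) ∈ c.target ∧ c.symm (c (ψ.symm w)) ∈ U ∧ v (c (ψ.symm w)) = v₀ (c (ψ.symm w)) ∧
      ContDiffAt ℝ ∞ R (c (ψ.symm w)) ∧ ContDiffAt ℝ ∞ y (c (ψ.symm w)) ∧
      fderiv ℝ y (c (ψ.symm w)) (v (c (ψ.symm w))) = 0 := by
    filter_upwards [ψ.open_target.eventually_mem hψt, hψx ▸ hesymm, hcψ.eventually hgood,
      hcψ.eventually hvv, hcψ.eventually hRe, hcψ.eventually hys, hcψ.eventually hyV]
      with w h1 h2 h3 h4 h5 h6 h7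
    exact ⟨h1, h2, h3.1, h3.2, h4, h5, h6, h7⟩
  obtain ⟨ρ, hρ, hball⟩ := Metric.eventually_nhds_iff_ball.1 hall
  set φ := (ψ.symm.restrOpen (Metric.ball (ψ x) ρ) Metric.isOpen_ball).symm with hφ
  have hφt : φ.target = Metric.ball (ψ x) ρ := by
    change ψ.target ∩ Metric.ball (ψ x) ρ = _
    exact Set.inter_eq_right.2 fun w hw => (hball w hw).1
  have hφψ : ∀ p, φ p = ψ p := fun _ => rfl
  have hφsrc : ∀ p ∈ φ.source, p ∈ ψ.source ∧ ψ p ∈ Metric.ball (ψ x) ρ := by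
    intro p hp
    have h1 : p ∈ ψ.source := by
      have h2 : φ p ∈ ψ.target := (hball _ (hφt ▸ φ.map_source hp)).1
      have h3 := ψ.map_target h2
      have h4 : ψ.symm (φ p) = p := φ.left_inv hp
      rwa [h4] at h3
    exact ⟨h1, hφt ▸ φ.map_source hp⟩
  have hprop : ∀ p ∈ φ.source, p ∈ c.source ∧ c p ∈ e.source ∧ p ∈ U ∧
      ContDiffAt ℝ ∞ R (c p) ∧ ContDiffAt ℝ ∞ y (c p) ∧
      fderiv ℝ y (c p) (mvfderiv I c p (V p)) = 0 := by
    intro p hp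
    obtain ⟨h1, h2⟩ := hφsrc p hp
    obtain ⟨-, -, -, h4, h5, h6, h7, h8⟩ := hball _ h2
    rw [ψ.left_inv h1] at h4 h5 h6 h7 h8
    have h1' := h1
    rw [hψ, OpenPartialHomeomorph.trans_source] at h1'
    rw [c.left_inv h1'.1] at h4
    rw [h5, hv₀c p h1'.1] at h8
    exact ⟨h1'.1, h1'.2, h4, h6, h7, h8⟩
  have hφg : ∀ p, φ p = g (c p) := fun p => by rw [← heg]; rfl
  have hφx : x ∈ φ.source := by
    have h1 : ψ x ∈ φ.target := by rw [hφt]; exact Metric.mem_ball_self hρ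
    have h2 := φ.map_target h1
    have h3 : φ.symm (ψ x) = x := ψ.left_inv hxψ
    rwa [h3] at h2
  have hgR : ∀ p ∈ φ.source, ContDiffAt ℝ ∞ g (c p) := fun p hp =>
    (hprop p hp).2.2.2.1.prodMk (hprop p hp).2.2.2.2.1
  have hφfun : (φ : M → ℝ × P) = fun p => g (c p) := funext hφg
  refine ⟨φ, ρ, ⟨?_, ?_⟩, hφx, fun p hp => (hprop p hp).2.2.1, hφt, ?_, ?_⟩
  · intro p hp
    rw [hφfun]
    exact ((hgR p hp).contMDiffAt.comp p
      (hc.contMDiffAt (hprop p hp).1)).contMDiffWithinAt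
  · intro w hw
    rw [hφt] at hw
    obtain ⟨h1, h2, -⟩ := hball w hw
    have h3 : e.symm w ∈ c.target := by
      rw [hψ, OpenPartialHomeomorph.trans_target] at h1
      exact h1.2
    exact (ContMDiffAt.comp w
      (hc.contMDiffOn_symm.contMDiffAt (c.open_target.mem_nhds h3))
      h2.contMDiffAt).contMDiffWithinAt
  · intro p hp
    rw [hφg, hg]
    simp only [hR]
    rw [c.left_inv (hprop p hp).1]
  · intro p hp
    obtain ⟨h1, -, h3, h4, h5, h6⟩ := hprop p hp
    rw [hφfun, hc.mvfderiv_comp h1 ((hgR p hp).differentiableAt hne), (hgd _ h4 h5).fderiv]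
    refine Prod.ext ?_ h6
    change fderiv ℝ R (c p) _ = -(R (c p))
    rw [hRV p h1 h3]
    simp only [hR]
    rw [c.left_inv h1]

end AdaptedCoordinates


/-! ### The metric in adapted coordinates -/

section Metric

variable {E : Type*} [NormedAddCommGroup E] [NormedSpace ℝ E]
  {H : Type*} [TopologicalSpace H] {I : ModelWithCorners ℝ E H}
  {M : Type*} [TopologicalSpace M] [ChartedSpace H M]
  [RiemannianBundle (fun p : M => TangentSpace I p)]
  [FiniteDimensional ℝ E] [IsManifold I ∞ M]
  [IsContMDiffRiemannianBundle I ∞ E (fun p : M => TangentSpace I p)]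

theorem mvfderiv_inner_self {V : Π p : M, TangentSpace I p} {p : M} (hV : MDiffAt (T% V) p)
    (h : ∀ v, leviCivita I M V p v = -v) (v : TangentSpace I p) :
    mvfderiv I (fun q => (inner ℝ (V q) (V q) : ℝ)) p v = -2 * inner ℝ (V p) v := by
  have hX := mdifferentiableAt_extend (I := I) (F := E) (V := fun p : M => TangentSpace I p) v
  have key := leviCivita_metric hX hV hV
  simp only [extend_apply_self, h, inner_neg_left, inner_neg_right] at key
  rw [key, real_inner_comm]
  ring

/-- For `r = |V|`, the equation `∇V = -1` says that `r dr = -⟨V, ·⟩`. -/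
theorem mvfderiv_norm {V : Π p : M, TangentSpace I p} {p : M} (hV : MDiffAt (T% V) p)
    (h : ∀ v, leviCivita I M V p v = -v) {r : M → ℝ} (hr : MDiffAt r p)
    (hrr : ∀ q, r q * r q = inner ℝ (V q) (V q)) (v : TangentSpace I p) :
    r p * mvfderiv I r p v = -inner ℝ (V p) v := by
  have h1 := mvfderiv_inner_self hV h v
  have h2 : (fun q => (inner ℝ (V q) (V q) : ℝ)) = r * r := funext fun q => (hrr q).symm
  rw [h2, mvfderiv_mul hr hr] at h1
  simp at h1
  linarith

variable {P : Type*} [NormedAddCommGroup P] [NormedSpace ℝ P]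
  {φ : OpenPartialHomeomorph M (ℝ × P)} (hφ : IsSmoothCoord I φ)
  {V : Π p : M, TangentSpace I p}

include hφ

/-- Coordinate fields `X` transverse to `∂/∂r` commute with `V = -r ∂/∂r`, hence
`∇_V X = ∇_X V = -X`. -/
theorem leviCivita_transverse {p : M} (hp : p ∈ φ.source) (hV : MDiffAt (T% V) p)
    (hVφ : ∀ q ∈ φ.source, mvfderiv I φ q (V q) = radial P (φ q))
    (h : ∀ v, leviCivita I M V p v = -v) (b : P) :
    leviCivita I M (coordField I φ fun _ => (0, b)) p (V p)
      = -coordField I φ (fun _ => (0, b)) p := by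
  have : CompleteSpace E := FiniteDimensional.complete ℝ E
  have hX : MDiffAt (T% (coordField I φ fun _ => ((0 : ℝ), b))) p :=
    hφ.mdifferentiableAt_coordField hp contDiffAt_const
  have ht := leviCivita_torsion hX hV
  have hVe : V =ᶠ[𝓝 p] coordField I φ (radial P) := by
    filter_upwards [φ.open_source.mem_nhds hp] with q hq
    exact ((hφ.coordField_eq_iff hq).2 (hVφ q hq)).symm
  have hbr : mlieBracket I (coordField I φ fun _ => ((0 : ℝ), b)) V p = 0 := by
    rw [Filter.EventuallyEq.mlieBracket_vectorField_eq
        (V₁ := coordField I φ fun _ => ((0 : ℝ), b)) (W₁ := V) Filter.EventuallyEq.rfl hVe,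
      hφ.mlieBracket_coordField hp contDiffAt_const contDiff_radial.contDiffAt,
      lieBracket_const_radial, hφ.coordField_eq_iff hp, map_zero]
    exact Prod.ext neg_zero.symm rfl
  rw [hbr, h, sub_eq_zero] at ht
  exact ht.symm

/-- The transverse coefficients `g(∂_b, ∂_b')` of the metric satisfy `r ∂_r g = 2 g`. -/
theorem fderiv_transverse_metric {p : M} (hp : p ∈ φ.source) (hV : MDiffAt (T% V) p)
    (hVφ : ∀ q ∈ φ.source, mvfderiv I φ q (V q) = radial P (φ q))
    (h : ∀ v, leviCivita I M V p v = -v) (b b' : P) :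
    (φ p).1 * fderiv ℝ (fun z => (inner ℝ (coordField I φ (fun _ => (0, b)) (φ.symm z))
        (coordField I φ (fun _ => (0, b')) (φ.symm z)) : ℝ)) (φ p) (1, 0)
      = 2 * inner ℝ (coordField I φ (fun _ => (0, b)) p) (coordField I φ (fun _ => (0, b')) p) := by
  have : CompleteSpace E := FiniteDimensional.complete ℝ E
  have hC : ∀ b : P, ContMDiffAt I I.tangent ∞ (T% (coordField I φ fun _ => ((0 : ℝ), b))) p :=
    fun b => hφ.contMDiffAt_coordField hp contDiffAt_const
  have hs := contMDiffAt_inner (hC b) (hC b')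
  have h1 := leviCivita_metric hV ((hC b).mdifferentiableAt (by simp))
    ((hC b').mdifferentiableAt (by simp))
  rw [leviCivita_transverse hφ hp hV hVφ h, leviCivita_transverse hφ hp hV hVφ h,
    hφ.mvfderiv_eq_fderiv_comp_symm hp hs, hVφ p hp, inner_neg_left, inner_neg_right] at h1
  have hr : radial P (φ p) = (-(φ p).1) • ((1 : ℝ), (0 : P)) := by simp [radial]
  rw [hr, map_smul, smul_eq_mul] at h1
  linarith

/-- The transverse part of the metric is homogeneous of degree two in `r`, as the range of the
coordinates is a ball, so that its radial slices are intervals. -/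
theorem transverse_metric_eq {z₀ : ℝ × P} {ρ : ℝ} (ht : φ.target = Metric.ball z₀ ρ)
    (hρ : 0 < ρ) (hpos : ∀ p ∈ φ.source, 0 < (φ p).1)
    (hV : ∀ p ∈ φ.source, MDiffAt (T% V) p)
    (hVφ : ∀ q ∈ φ.source, mvfderiv I φ q (V q) = radial P (φ q))
    (h : ∀ p ∈ φ.source, ∀ v, leviCivita I M V p v = -v) (b b' : P) {p : M} (hp : p ∈ φ.source) :
    (inner ℝ (coordField I φ (fun _ => (0, b)) p) (coordField I φ (fun _ => (0, b')) p) : ℝ)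
      = (φ p).1 ^ 2 * (inner ℝ (coordField I φ (fun _ => (0, b)) (φ.symm (z₀.1, (φ p).2)))
          (coordField I φ (fun _ => (0, b')) (φ.symm (z₀.1, (φ p).2))) / z₀.1 ^ 2) := by
  have : CompleteSpace E := FiniteDimensional.complete ℝ E
  set G : ℝ × P → ℝ := fun z => inner ℝ (coordField I φ (fun _ => (0, b)) (φ.symm z))
    (coordField I φ (fun _ => (0, b')) (φ.symm z)) with hG
  have hbox : ∀ t y, (t, y) ∈ φ.target ↔ t ∈ Metric.ball z₀.1 ρ ∧ y ∈ Metric.ball z₀.2 ρ := by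
    intro t y
    rw [ht, ← Prod.mk.eta (p := z₀), ← ball_prod_same]
    exact Iff.rfl
  have hy := ((hbox _ _).1 (φ.map_source hp)).2
  have hpos' : ∀ t ∈ Metric.ball z₀.1 ρ, 0 < t := by
    intro t ht'
    have h1 := (hbox t _).2 ⟨ht', hy⟩
    have h2 := hpos _ (φ.map_target h1)
    rwa [φ.right_inv h1] at h2
  have hGd : ∀ t ∈ Metric.ball z₀.1 ρ,
      HasDerivAt (fun t => G (t, (φ p).2)) (2 * G (t, (φ p).2) / t) t := by
    intro t ht'
    have h1 := (hbox t _).2 ⟨ht', hy⟩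
    have hq := φ.map_target h1
    have hGdiff : DifferentiableAt ℝ G (t, (φ p).2) := by
      have h3 := hφ.contDiffAt_comp_symm hq (contMDiffAt_inner
        (hφ.contMDiffAt_coordField hq (W := fun _ => ((0 : ℝ), b)) contDiffAt_const)
        (hφ.contMDiffAt_coordField hq (W := fun _ => ((0 : ℝ), b')) contDiffAt_const))
      rw [φ.right_inv h1] at h3
      exact h3.differentiableAt (by simp)
    have h4 := fderiv_transverse_metric hφ hq (hV _ hq) hVφ (h _ hq) b b'
    rw [φ.right_inv h1] at h4
    have h5 := hasDerivAt_radial_line hGdiff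
    have ht0 := (hpos' t ht').ne'
    have h6 : fderiv ℝ G (t, (φ p).2) (1, 0) = 2 * G (t, (φ p).2) / t := by
      rw [eq_div_iff ht0, mul_comm]
      exact h4
    rwa [h6] at h5
  have hkd : ∀ t ∈ Metric.ball z₀.1 ρ, HasDerivAt (fun t => G (t, (φ p).2) / t ^ 2) 0 t := by
    intro t ht'
    have ht0 := (hpos' t ht').ne'
    have h1 := (hGd t ht').div (hasDerivAt_pow 2 t) (pow_ne_zero 2 ht0)
    have h2 : (2 * G (t, (φ p).2) / t * t ^ 2 - G (t, (φ p).2) * ((2 : ℕ) * t ^ (2 - 1)))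
        / (t ^ 2) ^ 2 = 0 := by
      rw [div_eq_zero_iff]
      left
      simp only [Nat.cast_ofNat, Nat.add_one_sub_one, pow_one]
      field_simp
      ring
    rw [h2] at h1
    exact h1
  have hconst : G ((φ p).1, (φ p).2) / (φ p).1 ^ 2 = G (z₀.1, (φ p).2) / z₀.1 ^ 2 := Metric.isOpen_ball.is_const_of_deriv_eq_zero
    (convex_ball z₀.1 ρ).isPreconnected
    (fun t ht' => (hkd t ht').differentiableAt.differentiableWithinAt)
    (fun t ht' => (hkd t ht').deriv)
    ((hbox _ _).1 (φ.map_source hp)).1 (Metric.mem_ball_self hρ)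
  have hGp : G ((φ p).1, (φ p).2)
      = inner ℝ (coordField I φ (fun _ => (0, b)) p) (coordField I φ (fun _ => (0, b')) p) := by
    simp only [hG, Prod.mk.eta]
    rw [φ.left_inv hp]
  rw [← hGp, ← hconst]
  have hp0 := (hpos p hp).ne'
  field_simp

/-- The splitting of a tangent vector into its components along `V` and along the level sets of
`r`, which are orthogonal. -/
theorem inner_eq_radial_add_transverse {p : M} (hp : p ∈ φ.source) (hpos : 0 < (φ p).1)
    (hVφ : mvfderiv I φ p (V p) = radial P (φ p))
    (hgrad : ∀ v, inner ℝ (V p) v = -((φ p).1 * (mvfderiv I φ p v).1)) (v w : TangentSpace I p) :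
    inner ℝ v w = (mvfderiv I φ p v).1 * (mvfderiv I φ p w).1
      + inner ℝ (coordField I φ (fun _ => (0, (mvfderiv I φ p v).2)) p)
          (coordField I φ (fun _ => (0, (mvfderiv I φ p w).2)) p) := by
  have hsplit : ∀ u : TangentSpace I p, u = (-((mvfderiv I φ p u).1 / (φ p).1)) • V p
      + coordField I φ (fun _ => (0, (mvfderiv I φ p u).2)) p := by
    intro u
    have h1 : mvfderiv I φ p ((-((mvfderiv I φ p u).1 / (φ p).1)) • V p
        + coordField I φ (fun _ => (0, (mvfderiv I φ p u).2)) p) = mvfderiv I φ p u := by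
      rw [map_add, map_smul, hVφ, hφ.mvfderiv_coordField hp]
      refine Prod.ext ?_ ?_
      · simp only [radial, Prod.smul_mk, Prod.mk_add_mk, smul_eq_mul, add_zero]
        field_simp
      · simp [radial]
    have h2 := (hφ.coordField_eq_iff hp (W := fun _ => mvfderiv I φ p u)).2 h1
    rw [hφ.coordField_mvfderiv hp] at h2
    exact h2
  have hT : ∀ b : P, inner ℝ (V p) (coordField I φ (fun _ => ((0 : ℝ), b)) p) = 0 := by
    intro b
    rw [hgrad, hφ.mvfderiv_coordField hp]
    simp
  have hT' : ∀ b : P, inner ℝ (coordField I φ (fun _ => ((0 : ℝ), b)) p) (V p) = 0 := fun b => by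
    rw [real_inner_comm, hT]
  have hVV : inner ℝ (V p) (V p) = (φ p).1 ^ 2 := by
    rw [hgrad, hVφ]
    simp only [radial]
    ring
  conv_lhs => rw [hsplit v, hsplit w]
  rw [inner_add_left, inner_add_right, inner_add_right, inner_smul_left, inner_smul_right,
    inner_smul_left, inner_smul_right, hT, hT', hVV]
  simp only [conj_trivial]
  field_simp
  ring

end Metric

/-! ### Cones and fields with `∇V = -1` -/

section Cone

variable {E : Type*} [NormedAddCommGroup E] [NormedSpace ℝ E]
  {H : Type*} [TopologicalSpace H] {I : ModelWithCorners ℝ E H}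
  {M : Type*} [TopologicalSpace M] [ChartedSpace H M] {l : ℕ}
  {φ : OpenPartialHomeomorph M (ℝ × (Fin l → ℝ))} (hφ : IsSmoothCoord I φ)

include hφ

theorem IsSmoothCoord.mvfderiv_fst {p : M} (hp : p ∈ φ.source) (v : TangentSpace I p) :
    mvfderiv I (fun q => (φ q).1) p v = (mvfderiv I φ p v).1 := by
  rw [hφ.mvfderiv_comp (G := Prod.fst) hp differentiableAt_fst, fderiv_fst]
  rfl

theorem IsSmoothCoord.mvfderiv_snd_apply {p : M} (hp : p ∈ φ.source) (v : TangentSpace I p)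
    (i : Fin l) :
    mvfderiv I (fun q => (φ q).2 i) p v = (mvfderiv I φ p v).2 i := by
  have h : HasFDerivAt (fun z : ℝ × (Fin l → ℝ) => z.2 i)
      (ContinuousLinearMap.proj (R := ℝ) (φ := fun _ : Fin l => ℝ) i ∘L
        ContinuousLinearMap.snd ℝ ℝ (Fin l → ℝ)) (φ p) :=
    (ContinuousLinearMap.proj (R := ℝ) (φ := fun _ : Fin l => ℝ) i ∘L
      ContinuousLinearMap.snd ℝ ℝ (Fin l → ℝ)).hasFDerivAt
  rw [hφ.mvfderiv_comp (G := fun z : ℝ × (Fin l → ℝ) => z.2 i) hp h.differentiableAt, h.fderiv]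
  rfl

theorem IsSmoothCoord.coordField_eq_sum {p : M} (hp : p ∈ φ.source) (b : Fin l → ℝ) :
    coordField I φ (fun _ => (0, b)) p
      = ∑ i, b i • coordField I φ (fun _ => (0, Pi.single i 1)) p := by
  rw [hφ.coordField_eq_iff hp, map_sum]
  simp only [map_smul, hφ.mvfderiv_coordField hp]
  refine Prod.ext ?_ ?_
  · simp [Prod.fst_sum]
  · rw [Prod.snd_sum]
    ext j
    simp [Finset.sum_apply, Pi.single_apply]

end Cone

section Equivalence

variable {n : ℕ} {M : Type*} [TopologicalSpace M]
  [ChartedSpace (EuclideanSpace ℝ (Fin n)) M] [IsManifold (𝓡 n) ∞ M]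
  [RiemannianBundle (fun p : M => TangentSpace (𝓡 n) p)]
  [IsContMDiffRiemannianBundle (𝓡 n) ∞ (EuclideanSpace ℝ (Fin n))
    (fun p : M => TangentSpace (𝓡 n) p)] {x : M}

theorem IsConeAt.exists_field (hx : IsConeAt (𝓡 n) x) :
    ∃ (U : Set M) (V : Π p : M, TangentSpace (𝓡 n) p), IsOpen U ∧ x ∈ U ∧ IsSmoothFieldOn V U ∧
      V x ≠ 0 ∧ ∀ p ∈ U, ∀ v, leviCivita (𝓡 n) M V p v = -v := by
  obtain ⟨l, φ, f, hxφ, hφ₁, hφ₂, hpos, hg⟩ := hx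
  have hφ : IsSmoothCoord (𝓡 n) φ := ⟨hφ₁, hφ₂⟩
  refine ⟨φ.source, coordField (𝓡 n) φ (radial _), φ.open_source, hxφ, fun p hp =>
    (hφ.contMDiffAt_coordField hp contDiff_radial.contDiffAt).contMDiffWithinAt, ?_, ?_⟩
  · intro h0
    have h1 := congrArg Prod.fst (hφ.mvfderiv_coordField hxφ (radial _))
    rw [h0, map_zero] at h1
    have h2 := hpos x hxφ
    simp only [radial, Prod.fst_zero] at h1
    linarith
  · intro p hp v
    refine leviCivita_radial hφ (f := fun y a b => ∑ i, ∑ j, f i j y * (a i * b j)) ?_ ?_ hp v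
    · intro q hq v w
      rw [hg q hq]
      simp only [hφ.mvfderiv_fst hq, hφ.mvfderiv_snd_apply hq]
    · intro y b
      simp

theorem isConeAt_of_field {U : Set M} {V : Π p : M, TangentSpace (𝓡 n) p} (hU : IsOpen U)
    (hxU : x ∈ U) (hV : IsSmoothFieldOn V U) (hVx : V x ≠ 0)
    (h : ∀ p ∈ U, ∀ v, leviCivita (𝓡 n) M V p v = -v) : IsConeAt (𝓡 n) x := by
  obtain ⟨l, rfl⟩ : ∃ l, n = l + 1 := by
    refine Nat.exists_eq_succ_of_ne_zero ?_
    rintro rfl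
    have : Subsingleton (TangentSpace (𝓡 0) x) :=
      inferInstanceAs (Subsingleton (EuclideanSpace ℝ (Fin 0)))
    exact hVx (Subsingleton.elim _ _)
  set r : M → ℝ := fun q => √(inner ℝ (V q) (V q)) with hr
  have hrr : ∀ q, r q * r q = inner ℝ (V q) (V q) := fun q =>
    Real.mul_self_sqrt real_inner_self_nonneg
  have hVat : ∀ p ∈ U, ContMDiffAt (𝓡 (l + 1)) (𝓡 (l + 1)).tangent ∞ (T% V) p :=
    fun p hp => hV.contMDiffAt (hU.mem_nhds hp)
  have hVd : ∀ p ∈ U, MDifferentiableAt (𝓡 (l + 1)) (𝓡 (l + 1)).tangent (T% V) p := fun p hp => (hVat p hp).mdifferentiableAt (by simp)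
  have hVV : ∀ p ∈ U, ContMDiffAt (𝓡 (l + 1)) 𝓘(ℝ, ℝ) ∞
      (fun q => (inner ℝ (V q) (V q) : ℝ)) p :=
    fun p hp => contMDiffAt_inner (hVat p hp) (hVat p hp)
  set U' : Set M := U ∩ {q | (inner ℝ (V q) (V q) : ℝ) ≠ 0} with hU'
  have hU'o : IsOpen U' :=
    ContinuousOn.isOpen_inter_preimage
      (fun p hp => (hVV p hp).continuousAt.continuousWithinAt) hU isOpen_ne
  have hxU' : x ∈ U' := ⟨hxU, fun h0 => hVx (inner_self_eq_zero.1 h0)⟩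
  have hrpos : ∀ p ∈ U', 0 < r p := fun p hp =>
    Real.sqrt_pos.2 (lt_of_le_of_ne real_inner_self_nonneg (Ne.symm hp.2))
  have hrs : ∀ p ∈ U', ContMDiffAt (𝓡 (l + 1)) 𝓘(ℝ, ℝ) ∞ r p := fun p hp =>
    (Real.contDiffAt_sqrt hp.2).contMDiffAt.comp p (hVV p hp.1)
  have hdr : ∀ p ∈ U', ∀ v, r p * mvfderiv (𝓡 (l + 1)) r p v = -inner ℝ (V p) v := fun p hp =>
    mvfderiv_norm (hVd p hp.1) (h p hp.1) ((hrs p hp).mdifferentiableAt (by simp)) hrr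
  have hrV : ∀ p ∈ U', mvfderiv (𝓡 (l + 1)) r p (V p) = -r p := by
    intro p hp
    have h1 := hdr p hp (V p)
    rw [← hrr p] at h1
    exact mul_left_cancel₀ (hrpos p hp).ne' (by linarith)
  have hc : IsSmoothCoord (𝓡 (l + 1)) (chartAt (EuclideanSpace ℝ (Fin (l + 1))) x) :=
    ⟨contMDiffOn_chart, contMDiffOn_chart_symm⟩
  let L₀ : (ℝ × (Fin l → ℝ)) ≃L[ℝ] EuclideanSpace ℝ (Fin (l + 1)) :=
    ContinuousLinearEquiv.ofFinrankEq (by simp [add_comm])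
  obtain ⟨φ, ρ, hφ, hxφ, hsub, ht, hφr, hφV⟩ := exists_adaptedCoord L₀ hc
    (mem_chart_source _ x) hU'o hxU' (hV.mono Set.inter_subset_left) hrs hrV (hrpos x hxU').ne'
  have hpos : ∀ p ∈ φ.source, 0 < (φ p).1 := fun p hp => by
    rw [hφr p hp]; exact hrpos p (hsub hp)
  have hρ : 0 < ρ := by
    have := φ.map_source hxφ
    rw [ht] at this
    exact Metric.pos_of_mem_ball this
  refine ⟨l, φ, fun i j y =>
    inner ℝ (coordField (𝓡 (l + 1)) φ (fun _ => (0, Pi.single i 1)) (φ.symm ((φ x).1, y)))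
      (coordField (𝓡 (l + 1)) φ (fun _ => (0, Pi.single j 1)) (φ.symm ((φ x).1, y)))
        / (φ x).1 ^ 2, hxφ, hφ.contMDiffOn, hφ.contMDiffOn_symm, hpos, ?_⟩
  intro p hp v w
  have hgrad : ∀ v, inner ℝ (V p) v = -((φ p).1 * (mvfderiv (𝓡 (l + 1)) φ p v).1) := by
    intro v
    have h1 : mvfderiv (𝓡 (l + 1)) r p v = (mvfderiv (𝓡 (l + 1)) φ p v).1 := by
      rw [← hφ.mvfderiv_fst hp]
      refine mvfderiv_congr ?_ v
      filter_upwards [φ.open_source.mem_nhds hp] with q hq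
      exact (hφr q hq).symm
    rw [← h1, hφr p hp, hdr p (hsub hp), neg_neg]
  rw [inner_eq_radial_add_transverse hφ hp (hpos p hp) (hφV p hp) hgrad]
  simp only [hφ.mvfderiv_fst hp, hφ.mvfderiv_snd_apply hp]
  rw [hφ.coordField_eq_sum hp (mvfderiv (𝓡 (l + 1)) φ p v).2,
    hφ.coordField_eq_sum hp (mvfderiv (𝓡 (l + 1)) φ p w).2, sum_inner, Finset.mul_sum]
  congr 1
  refine Finset.sum_congr rfl fun i _ => ?_
  rw [inner_sum, Finset.mul_sum]
  refine Finset.sum_congr rfl fun j _ => ?_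
  rw [inner_smul_left, inner_smul_right, transverse_metric_eq hφ ht hρ hpos
    (fun q hq => hVd q (hsub hq).1) hφV (fun q hq => h q (hsub hq).1) _ _ hp]
  simp only [conj_trivial]
  ring

end Equivalence

end RiemCone

theorem proposition5p1 (n : ℕ) {M : Type*} [TopologicalSpace M]
    [ChartedSpace (EuclideanSpace ℝ (Fin n)) M] [IsManifold (𝓡 n) ∞ M]
    [RiemannianBundle (fun p : M => TangentSpace (𝓡 n) p)]
    [IsContMDiffRiemannianBundle (𝓡 n) ∞ (EuclideanSpace ℝ (Fin n))
      (fun p : M => TangentSpace (𝓡 n) p)]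
    (x : M) :
    RiemCone.IsConeAt (𝓡 n) x ↔
      ∃ (U : Set M) (V : Π p : M, TangentSpace (𝓡 n) p),
        IsOpen U ∧ x ∈ U ∧ RiemCone.IsSmoothFieldOn V U ∧ V x ≠ 0 ∧
        ∀ (W : Set M) (X : Π p : M, TangentSpace (𝓡 n) p),
          IsOpen W → x ∈ W → RiemCone.IsSmoothFieldOn X W →
          ∀ p ∈ U ∩ W, RiemCone.leviCivita (𝓡 n) M V p (X p) + X p = 0 := by
  constructor
  · intro hx
    obtain ⟨U, V, hU, hxU, hV, hVx, h⟩ := hx.exists_field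
    refine ⟨U, V, hU, hxU, hV, hVx, fun W X _ _ _ p hp => ?_⟩
    rw [h p hp.1, neg_add_cancel]
  · rintro ⟨U, V, hU, hxU, hV, hVx, h⟩
    set c := chartAt (EuclideanSpace ℝ (Fin n)) x with hc
    have hcs : RiemCone.IsSmoothCoord (𝓡 n) c := ⟨contMDiffOn_chart, contMDiffOn_chart_symm⟩
    have hxc : x ∈ c.source := mem_chart_source _ x
    refine RiemCone.isConeAt_of_field (hU.inter c.open_source) ⟨hxU, hxc⟩
      (hV.mono Set.inter_subset_left) hVx fun p hp v => ?_
    -- Every vector at `p` extends to a smooth field on the chart domain, a neighbourhood of `x`.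
    have h1 := h c.source (RiemCone.coordField (𝓡 n) c fun _ => mvfderiv (𝓡 n) c p v)
      c.open_source hxc
      (fun q hq => (hcs.contMDiffAt_coordField hq contDiffAt_const).contMDiffWithinAt) p hp
    rw [hcs.coordField_mvfderiv hp.2] at h1
    exact eq_neg_of_add_eq_zero_left h1
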